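/- For $n\ge 1$ let $T_n=(a_{i-j,n})_{i,j=1}^n$ be a random Toeplitz matrix whose complex input variables $a_{j,n}=x_{j,n}+\mathrm{i}\,y_{j,n}$, $j\in\mathbb Z$, satisfy the following pair-correlation assumption: $\mathbf E[a_{j,n}]=0$ for all $j\in\mathbb Z$; for each $n$ the vectors $(x_{j,n},x_{-j,n},y_{j,n},y_{-j,n})$, $j=0,1,2,\dots$, are independent; and there are real constants $\sigma_x,\sigma_y,\rho_1,\dots,\rho_6$ and $c_k<\infty$, not depending on $n$ and $j$, such that for all $n\ge 1$ (i) $\mathbf E[x_{j,n}^2]=\sigma_x^2$ and $\mathbf E[y_{j,n}^2]=\sigma_y^2$ for all $j\ne 0$; (ii) $\mathbf E[x_{j,n}y_{j,n}]=\rho_1$, $\mathbf E[x_{j,n}x_{-j,n}]=\rho_2$, $\mathbf E[x_{j,n}y_{-j,n}]=\rho_3$, $\mathbf E[x_{-j,n}y_{j,n}]=\rho_4$, $\mathbf E[y_{j,n}y_{-j,n}]=\rho_5$, $\mathbf E[x_{-j,n}y_{-j,n}]=\rho_6$ for all $j\ge 1$; (iii) $\mathbf E|x_{j,n}|^k\le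 c_k$ and $\mathbf E|y_{j,n}|^k\le c_k$ for all $j\in\mathbb Z$ and $k\ge 1$. For each $n$ let $T_n^{(1)},\dots,T_n^{(m)}$ be independent copies of $T_n$ (the Toeplitz matrices built from $m$ independent copies of the input sequence). Let $D_n^{(i)}=(d^{(i)}_{k-l})_{k,l=1}^n$, $1\le i\le m$, be deterministic Toeplitz matrices with complex $d^{(i)}_k$ satisfying $\sum_{k\in\mathbb Z}|d^{(i)}_k|<\infty$, and let $P_n$ be the $n\times n$ backward identity matrix, $(P_n)_{kl}=1$ if $k+l=n+1$ and $0$ otherwise. Put $\varphi_n(B)=\frac1n\mathbf E[\operatorname{Tr}B]$. Then $\{P_n,\ n^{-1/2}T_n^{(i)},\ D_n^{(i)}:\ 1\le i\le m\}$ converge jointly in $*$-distribution: there are a $*$-probability space $(\mathcal A,\varphi)$ (a unital complex $*$-algebra with a linear functional $\varphi$ such that $\varphi(1)=1$ and $\varphi(aa^*)\ge 0$ for all $a$) and elements $p,t_1,\dots,t_m,\delta_1,\dots,\delta_m\in\mathcal A$ such that for every monomial $q$ in noncommuting variables and their adjoints, $\varphi_n$ of $q$ evaluated at these matrices and their conjugate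 transposes is well defined (the trace is integrable) and converges, as $n\to\infty$, to $\varphi(q(p,t_1,\dots,t_m,\delta_1,\dots,\delta_m))$. In particular, $\{P_n,n^{-1/2}T_n,D_n\}$ converge jointly. Moreover, for every monomial $q$ in $p,t_i,\delta_i$ and their adjoints, let $q_{P,D}$ be obtained from $q$ by deleting all letters $t_i,t_i^*$, and $q_{P,T}$ by deleting all letters $\delta_i,\delta_i^*$, keeping the order of the remaining letters. Then $\varphi(q)=\varphi(q_{P,D})\,\varphi(q_{P,T})$, and $\varphi(q)=0$ if the number of letters $p,p^*$ in $q$ is odd or the number of letters $t_i,t_i^*$ in $q$ is odd. -/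

import Mathlib

open MeasureTheory ProbabilityTheory Filter Topology

/-- A `*`-probability space: a unital complex `*`-algebra with a normalized positive linear
functional. -/
structure StarProbabilitySpace where
  carrier : Type
  [ring : Ring carrier]
  [starRing : StarRing carrier]
  [algebra : Algebra ℂ carrier]
  [starModule : StarModule ℂ carrier]
  φ : carrier →ₗ[ℂ] ℂ
  φ_one : φ 1 = 1
  φ_nonneg : ∀ a : carrier, 0 ≤ (φ (a * star a)).re ∧ (φ (a * star a)).im = 0

attribute [instance] StarProbabilitySpace.ring StarProbabilitySpace.starRing
  StarProbabilitySpace.algebra StarProbabilitySpace.starModule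

/-- The `*`-monomial `x_{i₁}^{ε₁} ⋯ x_{i_k}^{ε_k}`; the Boolean `true` stands for `ε = *`.
For complex matrices `star` is the conjugate transpose. -/
def starMonomial {ι A : Type*} [Monoid A] [Star A] (x : ι → A) (w : List (ι × Bool)) : A :=
  (w.map fun p => if p.2 then star (x p.1) else x p.1).prod

/-- The state `φ_n(B) = n⁻¹ E[Tr B]` on random `n × n` matrices. -/
noncomputable def matrixState {Ω : Type*} [MeasurableSpace Ω] (μ : Measure Ω) {n : ℕ}
    (B : Ω → Matrix (Fin n) (Fin n) ℂ) : ℂ :=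
  (n : ℂ)⁻¹ * ∫ ω, (B ω).trace ∂μ

/-- Joint convergence in `*`-distribution of the families `(A n i)_i` of random `n × n` matrices
to the elements `x i` of `S`: every `*`-moment exists for `n ≥ 1` and converges to the
corresponding `*`-moment of the limit. -/
def ConvergesInStarDistribution {ι : Type*} {Ω : ℕ → Type*} [∀ n, MeasurableSpace (Ω n)]
    (μ : ∀ n, Measure (Ω n)) (A : ∀ n, ι → Ω n → Matrix (Fin n) (Fin n) ℂ)
    (S : StarProbabilitySpace) (x : ι → S.carrier) : Prop :=
  ∀ w : List (ι × Bool),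
    (∀ n, 1 ≤ n → Integrable (fun ω => (starMonomial (fun i => A n i ω) w).trace) (μ n)) ∧
    Tendsto (fun n => matrixState (μ n) fun ω => starMonomial (fun i => A n i ω) w) atTop
      (𝓝 (S.φ (starMonomial x w)))

/-- The `n × n` Toeplitz matrix `(a_{i-j})`. -/
def toeplitz (n : ℕ) (a : ℤ → ℂ) : Matrix (Fin n) (Fin n) ℂ :=
  Matrix.of fun i j => a ((i : ℤ) - (j : ℤ))

/-- The `n × n` backward identity. -/
def backwardIdentity (n : ℕ) : Matrix (Fin n) (Fin n) ℂ :=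
  Matrix.of fun i j => if i = Fin.rev j then 1 else 0

/-- The pair-correlation assumption on a complex input sequence `a_j = x_j + i y_j`, with
moment bounds `c k`. The second-moment conditions are imposed for `j ≠ 0` only. -/
structure PairCorrelated {Ω : Type*} [MeasurableSpace Ω] (μ : Measure Ω)
    (σx σy ρ₁ ρ₂ ρ₃ ρ₄ ρ₅ ρ₆ : ℝ) (c : ℕ → ℝ) (a : ℤ → Ω → ℂ) : Prop where
  measurable : ∀ j, Measurable (a j)
  mean_zero : ∀ j, ∫ ω, a j ω ∂μ = 0
  /-- `(x_j, x_{-j}, y_j, y_{-j})`, `j = 0, 1, 2, …`, are independent; the quadruple is coded by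
  the pair `(a_j, a_{-j})`. -/
  indep : iIndepFun (fun (j : ℕ) ω => (a (j : ℤ) ω, a (-(j : ℤ)) ω)) μ
  var_x : ∀ j, j ≠ 0 → ∫ ω, (a j ω).re ^ 2 ∂μ = σx ^ 2
  var_y : ∀ j, j ≠ 0 → ∫ ω, (a j ω).im ^ 2 ∂μ = σy ^ 2
  corr₁ : ∀ j, 0 < j → ∫ ω, (a j ω).re * (a j ω).im ∂μ = ρ₁
  corr₂ : ∀ j, 0 < j → ∫ ω, (a j ω).re * (a (-j) ω).re ∂μ = ρ₂
  corr₃ : ∀ j, 0 < j → ∫ ω, (a j ω).re * (a (-j) ω).im ∂μ = ρ₃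
  corr₄ : ∀ j, 0 < j → ∫ ω, (a (-j) ω).re * (a j ω).im ∂μ = ρ₄
  corr₅ : ∀ j, 0 < j → ∫ ω, (a j ω).im * (a (-j) ω).im ∂μ = ρ₅
  corr₆ : ∀ j, 0 < j → ∫ ω, (a (-j) ω).re * (a (-j) ω).im ∂μ = ρ₆
  moment_x : ∀ j k, 1 ≤ k → Integrable (fun ω => |(a j ω).re| ^ k) μ ∧
    ∫ ω, |(a j ω).re| ^ k ∂μ ≤ c k
  moment_y : ∀ j k, 1 ≤ k → Integrable (fun ω => |(a j ω).im| ^ k) μ ∧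
    ∫ ω, |(a j ω).im| ^ k ∂μ ≤ c k

/-- Names of the matrices: `P` for the backward identity, `T i` and `D i` for the random and the
deterministic Toeplitz matrices. -/
inductive Letter (m : ℕ) where
  | P : Letter m
  | T : Fin m → Letter m
  | D : Fin m → Letter m

/-- Is the letter `P`? -/
def Letter.isP {m : ℕ} : Letter m → Bool
  | .P => true
  | .T _ => false
  | .D _ => false

/-- Is the letter some `T i`? -/
def Letter.isT {m : ℕ} : Letter m → Bool
  | .P => false
  | .T _ => true
  | .D _ => false

/-- Is the letter some `D i`? -/
def Letter.isD {m : ℕ} : Letter m → Bool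
  | .P => false
  | .T _ => false
  | .D _ => true

/-- The matrices `P_n`, `n^{-1/2} T_n^{(i)}`, `D_n^{(i)}`, where `T_n^{(i)}` has input sequence
`a i` and `D_n^{(i)}` has input sequence `d i`. -/
noncomputable def modelMatrix {m : ℕ} {Ω : Type*} (n : ℕ) (a : Fin m → ℤ → Ω → ℂ)
    (d : Fin m → ℤ → ℂ) : Letter m → Ω → Matrix (Fin n) (Fin n) ℂ
  | .P, _ => backwardIdentity n
  | .T i, ω => (((Real.sqrt n)⁻¹ : ℝ) : ℂ) • toeplitz n (fun j => a i j ω)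
  | .D i, _ => toeplitz n (d i)

/-! The backward identity satisfies `P² = 1`, `P* = P` and `P T(b_k) = T(b_{-k}) P`. So every word
equals a product of Toeplitz matrices, with reflected or conjugated inputs, times `P^e`, where `e`
is the parity of the number of letters `P` (`flipMatrix_mul_starMonomial`). Expanding each factor
into shifts turns the trace into a weighted count of lattice paths in `[0, n)` that end at their
start `i`, or at `n - 1 - i` if `e` is odd (`trace_prod_toeplitz`).

Fix the steps `l` of the deterministic letters and sum over the steps of the `t` random ones, sorted
by pattern: which entries share an independent block, and with which signs. A block hit only once
gives zero, by independence and centring, so `q` blocks need `2q ≤ t`. There are `q + 1` free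
parameters (one absolute value per block, and the start) against the normalization `n^(-1-t/2)`, so
only pairings survive. For a pairing the mixed moment is a constant of the pattern, and the sum is a
Riemann sum (`tendsto_patternSum`). After division by `n` the fixed `l` is felt only in the closing
condition. If the signed random steps cancel identically, this condition reads `∑ l = 0`; otherwise,
and always for odd `e`, it cuts out a null hyperplane. The limit is thus `G` if `∑ l = 0` and `0` if
not, with `G` independent of `l` and of the deterministic inputs.

Dominated convergence over `l` gives the limit `constantTerm d * G` (`tendsto_sum_pathSum`). This
product is the asserted factorization: a deleted letter is replaced by the identity, which leaves
the reflections of the other letters alone. Deleting the `D` letters makes the first factor `1`;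
deleting the `T` letters makes the second factor `1` when the number of letters `P` is even, and
everything vanishes when it is odd. An odd number of letters `T` admits no pairing.

The limit space is the free `*`-algebra on the letters, with the limit moments as functional;
positivity is inherited from `n⁻¹ E Tr(BB*) ≥ 0` (`exists_starProbabilitySpace`). -/

/-! ### Transfer of the pair-correlation assumption to identically distributed copies -/

theorem PairCorrelated.of_identDistrib {Ω₀ Ω : Type*} [MeasurableSpace Ω₀] [MeasurableSpace Ω]
    {μ₀ : Measure Ω₀} {μ : Measure Ω} [IsProbabilityMeasure μ₀] [IsProbabilityMeasure μ]
    {σx σy ρ₁ ρ₂ ρ₃ ρ₄ ρ₅ ρ₆ : ℝ} {c : ℕ → ℝ} {a₀ : ℤ → Ω₀ → ℂ} {a : ℤ → Ω → ℂ}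
    (h : PairCorrelated μ₀ σx σy ρ₁ ρ₂ ρ₃ ρ₄ ρ₅ ρ₆ c a₀) (hm : ∀ j, Measurable (a j))
    (hid : IdentDistrib (fun ω j => a j ω) (fun ω j => a₀ j ω) μ μ₀) :
    PairCorrelated μ σx σy ρ₁ ρ₂ ρ₃ ρ₄ ρ₅ ρ₆ c a := by
  have key : ∀ (F : (ℤ → ℂ) → ℝ), Measurable F →
      ∫ ω, F (fun j => a j ω) ∂μ = ∫ ω, F (fun j => a₀ j ω) ∂μ₀ :=
    fun F hF => (hid.comp hF).integral_eq
  refine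
    { measurable := hm
      mean_zero := fun j => ?_
      indep := ?_
      var_x := fun j hj => ?_
      var_y := fun j hj => ?_
      corr₁ := fun j hj => ?_
      corr₂ := fun j hj => ?_
      corr₃ := fun j hj => ?_
      corr₄ := fun j hj => ?_
      corr₅ := fun j hj => ?_
      corr₆ := fun j hj => ?_
      moment_x := fun j k hk => ⟨?_, ?_⟩
      moment_y := fun j k hk => ⟨?_, ?_⟩ }
  · rw [← h.mean_zero j]
    exact (hid.comp (u := fun f : ℤ → ℂ => f j) (by fun_prop)).integral_eq
  · have h₀ := h.indep
    have hm₀ := h.measurable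
    -- Independence is restated as an identity between laws (the joint law is the product law),
    -- which equality in distribution preserves.
    rw [iIndepFun_iff_map_fun_eq_infinitePi_map (by fun_prop)] at h₀ ⊢
    have e₁ := (hid.comp (u := fun (f : ℤ → ℂ) (j : ℕ) => (f (j : ℤ), f (-(j : ℤ))))
      (by fun_prop)).map_eq
    have e₂ : ∀ j : ℕ, μ.map (fun ω => (a (j : ℤ) ω, a (-(j : ℤ)) ω)) =
        μ₀.map (fun ω => (a₀ (j : ℤ) ω, a₀ (-(j : ℤ)) ω)) := fun j =>
      (hid.comp (u := fun (f : ℤ → ℂ) => (f (j : ℤ), f (-(j : ℤ)))) (by fun_prop)).map_eq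
    simp only [Function.comp_def] at e₁
    simp only [e₁, e₂]
    exact h₀
  · rw [← h.var_x j hj]; exact key (fun f => (f j).re ^ 2) (by fun_prop)
  · rw [← h.var_y j hj]; exact key (fun f => (f j).im ^ 2) (by fun_prop)
  · rw [← h.corr₁ j hj]; exact key (fun f => (f j).re * (f j).im) (by fun_prop)
  · rw [← h.corr₂ j hj]; exact key (fun f => (f j).re * (f (-j)).re) (by fun_prop)
  · rw [← h.corr₃ j hj]; exact key (fun f => (f j).re * (f (-j)).im) (by fun_prop)
  · rw [← h.corr₄ j hj]; exact key (fun f => (f (-j)).re * (f j).im) (by fun_prop)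
  · rw [← h.corr₅ j hj]; exact key (fun f => (f j).im * (f (-j)).im) (by fun_prop)
  · rw [← h.corr₆ j hj]; exact key (fun f => (f (-j)).re * (f (-j)).im) (by fun_prop)
  · exact (hid.comp (u := fun f : ℤ → ℂ => |(f j).re| ^ k) (by fun_prop)).integrable_iff.2
      (h.moment_x j k hk).1
  · exact (key (fun f => |(f j).re| ^ k) (by fun_prop)).trans_le (h.moment_x j k hk).2
  · exact (hid.comp (u := fun f : ℤ → ℂ => |(f j).im| ^ k) (by fun_prop)).integrable_iff.2
      (h.moment_y j k hk).1
  · exact (key (fun f => |(f j).im| ^ k) (by fun_prop)).trans_le (h.moment_y j k hk).2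

/-! ### Moments of a single input sequence -/

/-- Conjugation of `z` when `b` holds. -/
noncomputable def conjIf (b : Bool) (z : ℂ) : ℂ := if b then star z else z

/-- Negation of `k` when `b` holds. -/
def negIf (b : Bool) (k : ℤ) : ℤ := if b then -k else k

theorem natAbs_negIf (b : Bool) (k : ℤ) : (negIf b k).natAbs = k.natAbs := by
  cases b <;> simp [negIf]

theorem norm_conjIf (b : Bool) (z : ℂ) : ‖conjIf b z‖ = ‖z‖ := by
  cases b <;> simp [conjIf]

@[fun_prop]
theorem measurable_conjIf (b : Bool) : Measurable (conjIf b) := by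
  cases b
  · exact measurable_id
  · exact continuous_star.measurable

/-- The real part (`e = false`) or imaginary part (`e = true`). -/
def rePart (e : Bool) (z : ℂ) : ℝ := if e then z.im else z.re

/-- The correlations are prescribed for real and imaginary parts; this reduces every complex second
moment to those four real ones. -/
theorem conjIf_mul_conjIf (c c' : Bool) (z z' : ℂ) :
    conjIf c z * conjIf c' z' =
      ((rePart false z * rePart false z' : ℝ) : ℂ) +
      (if c' then -Complex.I else Complex.I) * ((rePart false z * rePart true z' : ℝ) : ℂ) +
      (if c then -Complex.I else Complex.I) * ((rePart true z * rePart false z' : ℝ) : ℂ) +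
      (if c then -Complex.I else Complex.I) * (if c' then -Complex.I else Complex.I) *
        ((rePart true z * rePart true z' : ℝ) : ℂ) := by
  cases c <;> cases c' <;> apply Complex.ext <;> simp [conjIf, rePart] <;> ring

theorem integral_add_three_const_mul {Ω : Type*} [MeasurableSpace Ω] {μ : Measure Ω}
    {f₀ f₁ f₂ f₃ : Ω → ℂ} {z₁ z₂ z₃ : ℂ} (h₀ : Integrable f₀ μ) (h₁ : Integrable f₁ μ)
    (h₂ : Integrable f₂ μ) (h₃ : Integrable f₃ μ) :
    ∫ ω, (f₀ ω + z₁ * f₁ ω + z₂ * f₂ ω + z₃ * f₃ ω) ∂μ =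
      ∫ ω, f₀ ω ∂μ + z₁ * ∫ ω, f₁ ω ∂μ + z₂ * ∫ ω, f₂ ω ∂μ + z₃ * ∫ ω, f₃ ω ∂μ := by
  have k₁ := h₁.const_mul z₁
  have k₂ := h₂.const_mul z₂
  have k₃ := h₃.const_mul z₃
  have e₁ : Integrable (fun ω => f₀ ω + z₁ * f₁ ω) μ := h₀.add k₁
  have e₂ : Integrable (fun ω => f₀ ω + z₁ * f₁ ω + z₂ * f₂ ω) μ := e₁.add k₂
  rw [integral_add e₂ k₃, integral_add e₁ k₂, integral_add h₀ k₁]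
  simp only [integral_const_mul]

/-- The second moment of the parts `e`, `e'` of `a_j`, `a_j'` with `|j| = |j'| ≠ 0`, where `s`, `s'`
tell whether `j`, `j'` are negative. -/
def secondMoment (σx σy ρ₁ ρ₂ ρ₃ ρ₄ ρ₅ ρ₆ : ℝ) : Bool → Bool → Bool → Bool → ℝ
  | false, false, s, s' => if s = s' then σx ^ 2 else ρ₂
  | true, true, s, s' => if s = s' then σy ^ 2 else ρ₅
  | false, true, false, false => ρ₁
  | false, true, false, true => ρ₃
  | false, true, true, false => ρ₄
  | false, true, true, true => ρ₆
  | true, false, false, false => ρ₁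
  | true, false, true, false => ρ₃
  | true, false, false, true => ρ₄
  | true, false, true, true => ρ₆

namespace PairCorrelated

variable {Ω Ω' : Type*} [MeasurableSpace Ω] [MeasurableSpace Ω'] {μ : Measure Ω}
  {μ' : Measure Ω'} {σx σy ρ₁ ρ₂ ρ₃ ρ₄ ρ₅ ρ₆ : ℝ} {c : ℕ → ℝ} {a : ℤ → Ω → ℂ} {a' : ℤ → Ω' → ℂ}

theorem integrable_rePart_mul (h : PairCorrelated μ σx σy ρ₁ ρ₂ ρ₃ ρ₄ ρ₅ ρ₆ c a)
    (e e' : Bool) (j j' : ℤ) : Integrable (fun ω => rePart e (a j ω) * rePart e' (a j' ω)) μ := by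
  have hm := h.measurable
  have hsq : ∀ (e : Bool) (j : ℤ), MemLp (fun ω => rePart e (a j ω)) 2 μ := by
    intro e j
    rw [memLp_two_iff_integrable_sq]
    · cases e
      · simpa [rePart] using (h.moment_x j 2 (by norm_num)).1
      · simpa [rePart] using (h.moment_y j 2 (by norm_num)).1
    · cases e
      · exact Measurable.aestronglyMeasurable
          (by simp only [rePart, Bool.false_eq_true, if_false]; fun_prop)
      · exact Measurable.aestronglyMeasurable (by simp only [rePart, if_true]; fun_prop)
  exact (hsq e j).integrable_mul (hsq e' j')

theorem integral_rePart_mul (h : PairCorrelated μ σx σy ρ₁ ρ₂ ρ₃ ρ₄ ρ₅ ρ₆ c a)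
    (e e' s s' : Bool) {N : ℤ} (hN : 0 < N) :
    ∫ ω, rePart e (a (negIf s N) ω) * rePart e' (a (negIf s' N) ω) ∂μ =
      secondMoment σx σy ρ₁ ρ₂ ρ₃ ρ₄ ρ₅ ρ₆ e e' s s' := by
  have hN0 : N ≠ 0 := hN.ne'
  have hN1 : -N ≠ 0 := by omega
  have v₁ := h.var_x N hN0
  have v₂ := h.var_x (-N) hN1
  have v₃ := h.var_y N hN0
  have v₄ := h.var_y (-N) hN1
  have h₁ := h.corr₁ N hN
  have h₂ := h.corr₂ N hN
  have h₃ := h.corr₃ N hN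
  have h₄ := h.corr₄ N hN
  have h₅ := h.corr₅ N hN
  have h₆ := h.corr₆ N hN
  simp only [pow_two] at v₁ v₂ v₃ v₄
  cases e <;> cases e' <;> cases s <;> cases s' <;>
    simp only [rePart, negIf, secondMoment, if_true, if_false, Bool.false_eq_true, pow_two,
      reduceCtorEq] <;>
    first
    | assumption
    | (simp only [mul_comm] at *; assumption)

/-- Both sides expand into the same combination of values of `secondMoment`, which sees only the
signs of the indices and not their size. Two probability spaces are allowed so that different `n`
can be compared. -/
theorem integral_conjIf_mul_congr (h : PairCorrelated μ σx σy ρ₁ ρ₂ ρ₃ ρ₄ ρ₅ ρ₆ c a)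
    (h' : PairCorrelated μ' σx σy ρ₁ ρ₂ ρ₃ ρ₄ ρ₅ ρ₆ c a') (b b' : Bool) {j j' k k' : ℤ}
    (hj : j ≠ 0) (hk : k ≠ 0) (hjj : j.natAbs = j'.natAbs) (hkk : k.natAbs = k'.natAbs)
    (hs : 0 ≤ j ↔ 0 ≤ k) (hs' : 0 ≤ j' ↔ 0 ≤ k') :
    ∫ ω, conjIf b (a j ω) * conjIf b' (a j' ω) ∂μ =
      ∫ ω, conjIf b (a' k ω) * conjIf b' (a' k' ω) ∂μ' := by
  have expand : ∀ (e e' : Bool), ∫ ω, rePart e (a j ω) * rePart e' (a j' ω) ∂μ =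
      ∫ ω, rePart e (a' k ω) * rePart e' (a' k' ω) ∂μ' := by
    intro e e'
    have r₁ : j = negIf (decide (j < 0)) j.natAbs := by
      by_cases hlt : j < 0 <;>
        simp only [negIf, hlt, decide_true, decide_false, if_true, if_false, Bool.false_eq_true] <;>
        omega
    have r₂ : j' = negIf (decide (j' < 0)) j.natAbs := by
      by_cases hlt : j' < 0 <;>
        simp only [negIf, hlt, decide_true, decide_false, if_true, if_false, Bool.false_eq_true] <;>
        omega
    have r₃ : k = negIf (decide (j < 0)) k.natAbs := by
      by_cases hlt : j < 0 <;>
        simp only [negIf, hlt, decide_true, decide_false, if_true, if_false, Bool.false_eq_true] <;>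
        omega
    have r₄ : k' = negIf (decide (j' < 0)) k.natAbs := by
      by_cases hlt : j' < 0 <;>
        simp only [negIf, hlt, decide_true, decide_false, if_true, if_false, Bool.false_eq_true] <;>
        omega
    rw [r₃, r₄, h'.integral_rePart_mul e e' _ _ (N := k.natAbs) (by omega)]
    conv_lhs => rw [r₁, r₂]
    rw [h.integral_rePart_mul e e' _ _ (N := j.natAbs) (by omega)]
  simp only [conjIf_mul_conjIf]
  have i₁ : ∀ e e', Integrable (fun ω => ((rePart e (a j ω) * rePart e' (a j' ω) : ℝ) : ℂ)) μ :=
    fun e e' => (h.integrable_rePart_mul e e' j j').ofReal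
  have i₂ : ∀ e e', Integrable (fun ω => ((rePart e (a' k ω) * rePart e' (a' k' ω) : ℝ) : ℂ)) μ' :=
    fun e e' => (h'.integrable_rePart_mul e e' k k').ofReal
  rw [integral_add_three_const_mul (i₁ _ _) (i₁ _ _) (i₁ _ _) (i₁ _ _),
    integral_add_three_const_mul (i₂ _ _) (i₂ _ _) (i₂ _ _) (i₂ _ _)]
  simp only [integral_complex_ofReal, expand]

theorem norm_pow_bound (h : PairCorrelated μ σx σy ρ₁ ρ₂ ρ₃ ρ₄ ρ₅ ρ₆ c a) {k : ℕ} (hk : 1 ≤ k)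
    (j : ℤ) : Integrable (fun ω => ‖a j ω‖ ^ k) μ ∧
      ∫ ω, ‖a j ω‖ ^ k ∂μ ≤ 2 ^ (k - 1) * (c k + c k) := by
  have hx := h.moment_x j k hk
  have hy := h.moment_y j k hk
  have hi : Integrable (fun ω => 2 ^ (k - 1) * (|(a j ω).re| ^ k + |(a j ω).im| ^ k)) μ :=
    (hx.1.add hy.1).const_mul _
  have hle : ∀ ω, ‖a j ω‖ ^ k ≤ 2 ^ (k - 1) * (|(a j ω).re| ^ k + |(a j ω).im| ^ k) := fun ω =>
    (pow_le_pow_left₀ (norm_nonneg _) (Complex.norm_le_abs_re_add_abs_im _) k).trans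
      (add_pow_le (abs_nonneg _) (abs_nonneg _) k)
  have hm := h.measurable j
  have hint : Integrable (fun ω => ‖a j ω‖ ^ k) μ := by
    refine hi.mono' (by fun_prop) (Eventually.of_forall fun ω => ?_)
    rw [Real.norm_of_nonneg (by positivity)]
    exact hle ω
  refine ⟨hint, (integral_mono hint hi hle).trans ?_⟩
  rw [integral_const_mul, integral_add hx.1 hy.1]
  gcongr
  · exact hx.2
  · exact hy.2

end PairCorrelated

/-! ### Mixed moments of the random entries -/

/-- The product is at most a power of its largest factor. This crude form of Hölder's inequality
bounds mixed moments by absolute moments of single entries. -/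
theorem Finset.prod_le_sum_pow_card {ι : Type*} (s : Finset ι) (hs : s.Nonempty) (f : ι → ℝ)
    (hf : ∀ i, 0 ≤ f i) : ∏ i ∈ s, f i ≤ ∑ i ∈ s, f i ^ s.card := by
  obtain ⟨i, hi, hmax⟩ := s.exists_max_image f hs
  calc ∏ i ∈ s, f i ≤ ∏ _j ∈ s, f i := Finset.prod_le_prod (fun j _ => hf j) hmax
    _ = f i ^ s.card := by simp
    _ ≤ _ := Finset.single_le_sum (f := fun i => f i ^ s.card)
      (fun j _ => pow_nonneg (hf j) _) hi

/-- The entry attached to a `T` letter: `t.1` is the number of the copy, `t.2.1` tells whether the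
index is reflected and `t.2.2` whether the value is conjugated. -/
noncomputable def inputEntry {m : ℕ} {Ω : Type*} (a : Fin m → ℤ → Ω → ℂ) (t : Fin m × Bool × Bool)
    (k : ℤ) (ω : Ω) : ℂ :=
  conjIf t.2.2 (a t.1 (negIf t.2.1 k) ω)

/-- The mixed moment `E ∏ₛ a_{k_s}` attached to a family of `T` letters. -/
noncomputable def mixedMoment {m : ℕ} {Ω T : Type*} [Fintype T] [MeasurableSpace Ω]
    (μ : Measure Ω) (a : Fin m → ℤ → Ω → ℂ) (τ : T → Fin m × Bool × Bool) (k : T → ℤ) : ℂ :=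
  ∫ ω, ∏ s, inputEntry a (τ s) (k s) ω ∂μ

/-- The independent block to which the entry with label `t` and index `k` belongs. -/
def entryKey {m : ℕ} {T : Type*} (τ : T → Fin m × Bool × Bool) (k : T → ℤ) (s : T) :
    Fin m × ℕ :=
  ((τ s).1, (k s).natAbs)

section MixedMoment

variable {m : ℕ} {Ω Ω' T : Type*} [Fintype T] [MeasurableSpace Ω] [MeasurableSpace Ω']
  {μ : Measure Ω} {μ' : Measure Ω'} {σx σy ρ₁ ρ₂ ρ₃ ρ₄ ρ₅ ρ₆ : ℝ} {c : ℕ → ℝ}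
  {a : Fin m → ℤ → Ω → ℂ} {a' : Fin m → ℤ → Ω' → ℂ}

theorem measurable_inputEntry (h : ∀ i, PairCorrelated μ σx σy ρ₁ ρ₂ ρ₃ ρ₄ ρ₅ ρ₆ c (a i))
    (t : Fin m × Bool × Bool) (k : ℤ) : Measurable (inputEntry a t k) :=
  (measurable_conjIf _).comp ((h _).measurable _)

theorem integrable_prod_inputEntry [IsProbabilityMeasure μ]
    (h : ∀ i, PairCorrelated μ σx σy ρ₁ ρ₂ ρ₃ ρ₄ ρ₅ ρ₆ c (a i))
    (τ : T → Fin m × Bool × Bool) (k : T → ℤ) :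
    Integrable (fun ω => ∏ s, inputEntry a (τ s) (k s) ω) μ := by
  rcases isEmpty_or_nonempty T with hT | hT
  · simp
  have hm := measurable_inputEntry h
  refine Integrable.mono'
    (g := fun ω => ∑ s, ‖inputEntry a (τ s) (k s) ω‖ ^ (Finset.univ : Finset T).card) ?_
    (Finset.measurable_fun_prod _ fun s _ => hm _ _).aestronglyMeasurable
    (Eventually.of_forall fun ω => ?_)
  · refine integrable_finsetSum _ fun s _ => ?_
    simp only [inputEntry, norm_conjIf]
    exact ((h _).norm_pow_bound (Finset.univ_nonempty.card_pos) _).1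
  · rw [norm_prod]
    exact Finset.prod_le_sum_pow_card _ Finset.univ_nonempty _ fun _ => norm_nonneg _

theorem norm_mixedMoment_le [IsProbabilityMeasure μ]
    (h : ∀ i, PairCorrelated μ σx σy ρ₁ ρ₂ ρ₃ ρ₄ ρ₅ ρ₆ c (a i))
    (τ : T → Fin m × Bool × Bool) (k : T → ℤ) :
    ‖mixedMoment μ a τ k‖ ≤ max 1 (Fintype.card T * (2 ^ (Fintype.card T - 1) *
      (c (Fintype.card T) + c (Fintype.card T)))) := by
  rcases isEmpty_or_nonempty T with hT | hT
  · simp [mixedMoment]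
  refine le_max_of_le_right ?_
  have hc : 1 ≤ Fintype.card T := Fintype.card_pos
  have hi : ∀ s, Integrable (fun ω => ‖inputEntry a (τ s) (k s) ω‖ ^ Fintype.card T) μ := by
    intro s
    simp only [inputEntry, norm_conjIf]
    exact ((h _).norm_pow_bound hc _).1
  calc ‖mixedMoment μ a τ k‖ ≤ ∫ ω, ∑ s, ‖inputEntry a (τ s) (k s) ω‖ ^ Fintype.card T ∂μ := by
        refine norm_integral_le_of_norm_le (integrable_finsetSum _ fun s _ => hi s)
          (Eventually.of_forall fun ω => ?_)
        rw [norm_prod]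
        exact Finset.prod_le_sum_pow_card _ Finset.univ_nonempty _ fun _ => norm_nonneg _
    _ = ∑ s, ∫ ω, ‖inputEntry a (τ s) (k s) ω‖ ^ Fintype.card T ∂μ :=
        integral_finsetSum _ fun s _ => hi s
    _ ≤ ∑ _s : T, (2 ^ (Fintype.card T - 1) * (c (Fintype.card T) + c (Fintype.card T))) := by
        refine Finset.sum_le_sum fun s _ => ?_
        simp only [inputEntry, norm_conjIf]
        exact ((h _).norm_pow_bound hc _).2
    _ = _ := by simp

/-- Two levels of independence are merged: between the copies, and within a copy between different
absolute values of the index. -/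
theorem iIndepFun_blocks (h : ∀ i, PairCorrelated μ σx σy ρ₁ ρ₂ ρ₃ ρ₄ ρ₅ ρ₆ c (a i))
    (hind : iIndepFun (fun i ω j => a i j ω) μ) :
    iIndepFun (fun (p : Fin m × ℕ) ω => (a p.1 (p.2 : ℤ) ω, a p.1 (-(p.2 : ℤ)) ω)) μ := by
  have hm := fun i => (h i).measurable
  refine iIndepFun_uncurry' (X := fun i (j : ℕ) ω => (a i (j : ℤ) ω, a i (-(j : ℤ)) ω))
    (fun i j => by fun_prop) ?_ fun i => (h i).indep
  exact hind.comp (fun _ (f : ℤ → ℂ) (j : ℕ) => (f (j : ℤ), f (-(j : ℤ)))) fun i => by fun_prop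

open scoped Classical in
-- Distinct classes of the kernel belong to distinct independent blocks, and the product over a
-- class is a function of its block. `S` is kept as a variable so that two index families with equal
-- kernels can be compared over the same quotient.
theorem mixedMoment_eq_prod (h : ∀ i, PairCorrelated μ σx σy ρ₁ ρ₂ ρ₃ ρ₄ ρ₅ ρ₆ c (a i))
    (hind : iIndepFun (fun i ω j => a i j ω) μ) (τ : T → Fin m × Bool × Bool) (k : T → ℤ)
    (S : Setoid T) (hS : S = Setoid.ker (entryKey τ k)) :
    mixedMoment μ a τ k = ∏ q : Quotient S,
      ∫ ω, ∏ s with Quotient.mk S s = q, inputEntry a (τ s) (k s) ω ∂μ := by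
  subst hS
  have hm := fun i => (h i).measurable
  have hinj := Setoid.kerLift_injective (entryKey τ k)
  have hX := (iIndepFun_blocks h hind).precomp hinj
  -- A block is `(a_j, a_{-j})` with `j ≥ 0`, and the sign of the reflected index selects the
  -- coordinate. For `j = 0` the two coordinates agree.
  set f : Quotient (Setoid.ker (entryKey τ k)) → ℂ × ℂ → ℂ := fun q z =>
    ∏ s with Quotient.mk _ s = q,
      conjIf (τ s).2.2 (if 0 ≤ negIf (τ s).2.1 (k s) then z.1 else z.2) with hf
  have hfm : ∀ q, Measurable (f q) := fun q => by
    refine Finset.measurable_fun_prod _ fun s _ => (measurable_conjIf _).comp ?_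
    split_ifs
    · exact measurable_fst
    · exact measurable_snd
  have hfX : ∀ q ω, f q (a (Setoid.kerLift (entryKey τ k) q).1
        ((Setoid.kerLift (entryKey τ k) q).2 : ℤ) ω,
      a (Setoid.kerLift (entryKey τ k) q).1 (-((Setoid.kerLift (entryKey τ k) q).2 : ℤ)) ω) =
      ∏ s with Quotient.mk _ s = q, inputEntry a (τ s) (k s) ω := by
    intro q ω
    refine Finset.prod_congr rfl fun s hs => ?_
    obtain rfl := (Finset.mem_filter.1 hs).2
    have hl : Setoid.kerLift (entryKey τ k) (Quotient.mk _ s) = ((τ s).1, (k s).natAbs) := rfl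
    have hn := natAbs_negIf (τ s).2.1 (k s)
    rw [hl]
    simp only [inputEntry]
    split_ifs with hp
    · rw [show (((k s).natAbs : ℕ) : ℤ) = negIf (τ s).2.1 (k s) by omega]
    · rw [show -(((k s).natAbs : ℕ) : ℤ) = negIf (τ s).2.1 (k s) by omega]
  have := hX.integral_fun_prod_comp (f := f) (fun q => by fun_prop)
    (fun q => (hfm q).aestronglyMeasurable)
  simp only [hfX] at this
  rw [← this, mixedMoment]
  congr 1
  ext ω
  exact (Finset.prod_fiberwise _ _ _).symm

/-- An entry alone in its block contributes its mean as a factor. -/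
theorem mixedMoment_eq_zero (h : ∀ i, PairCorrelated μ σx σy ρ₁ ρ₂ ρ₃ ρ₄ ρ₅ ρ₆ c (a i))
    (hind : iIndepFun (fun i ω j => a i j ω) μ) (τ : T → Fin m × Bool × Bool) (k : T → ℤ)
    (s : T) (hs : ∀ s', entryKey τ k s' = entryKey τ k s → s' = s) :
    mixedMoment μ a τ k = 0 := by
  classical
  rw [mixedMoment_eq_prod h hind τ k _ rfl]
  refine Finset.prod_eq_zero (Finset.mem_univ (Quotient.mk _ s)) ?_
  have : (Finset.univ.filter fun s' =>
      (Quotient.mk (Setoid.ker (entryKey τ k)) s') = Quotient.mk _ s) = {s} := by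
    ext s'
    simp only [Finset.mem_filter, Finset.mem_univ, true_and, Finset.mem_singleton, Quotient.eq,
      Setoid.ker_def]
    exact ⟨hs s', fun e => e ▸ rfl⟩
  rw [this]
  simp only [Finset.prod_singleton, inputEntry, conjIf]
  have h0 := (h (τ s).1).mean_zero (negIf (τ s).2.1 (k s))
  split_ifs
  · have := integral_conj (μ := μ) (f := fun ω => a (τ s).1 (negIf (τ s).2.1 (k s)) ω)
    rw [h0, map_zero] at this
    exact this
  · exact h0

open scoped Classical in
-- When all classes are pairs, every factor is a second moment determined by the letters and the
-- signs. Zero indices are excluded because the second moments of `a_0` are not prescribed.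
theorem mixedMoment_congr (h : ∀ i, PairCorrelated μ σx σy ρ₁ ρ₂ ρ₃ ρ₄ ρ₅ ρ₆ c (a i))
    (hind : iIndepFun (fun i ω j => a i j ω) μ)
    (h' : ∀ i, PairCorrelated μ' σx σy ρ₁ ρ₂ ρ₃ ρ₄ ρ₅ ρ₆ c (a' i))
    (hind' : iIndepFun (fun i ω j => a' i j ω) μ') (τ : T → Fin m × Bool × Bool) (k k' : T → ℤ)
    (hker : Setoid.ker (entryKey τ k) = Setoid.ker (entryKey τ k'))
    (hcard : ∀ s, (Finset.univ.filter fun s' => entryKey τ k s' = entryKey τ k s).card = 2)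
    (hk : ∀ s, k s ≠ 0) (hk' : ∀ s, k' s ≠ 0) (hsign : ∀ s, 0 ≤ k s ↔ 0 ≤ k' s) :
    mixedMoment μ a τ k = mixedMoment μ' a' τ k' := by
  rw [mixedMoment_eq_prod h hind τ k _ rfl, mixedMoment_eq_prod h' hind' τ k' _ hker]
  refine Finset.prod_congr rfl fun q _ => ?_
  obtain ⟨s₀, rfl⟩ := Quotient.exists_rep q
  have hset : (Finset.univ.filter fun s' =>
      (Quotient.mk (Setoid.ker (entryKey τ k)) s') = Quotient.mk _ s₀) =
      Finset.univ.filter fun s' => entryKey τ k s' = entryKey τ k s₀ := by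
    ext s'
    simp only [Finset.mem_filter, Finset.mem_univ, true_and, Quotient.eq, Setoid.ker_def]
  rw [hset]
  obtain ⟨s, s', hne, hss⟩ := Finset.card_eq_two.1 (hcard s₀)
  rw [hss]
  simp only [Finset.prod_pair hne]
  have e₁ : entryKey τ k s = entryKey τ k s' := by
    have m₁ : s ∈ Finset.univ.filter fun s' => entryKey τ k s' = entryKey τ k s₀ := by simp [hss]
    have m₂ : s' ∈ Finset.univ.filter fun s' => entryKey τ k s' = entryKey τ k s₀ := by simp [hss]
    exact (Finset.mem_filter.1 m₁).2.trans (Finset.mem_filter.1 m₂).2.symm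
  have e₂ : entryKey τ k' s = entryKey τ k' s' := by
    have : Setoid.ker (entryKey τ k) s s' := e₁
    rw [hker] at this
    exact this
  simp only [entryKey, Prod.mk.injEq] at e₁ e₂
  have hn : ∀ (b : Bool) (k k' : ℤ), k ≠ 0 → k' ≠ 0 → (0 ≤ k ↔ 0 ≤ k') →
      (0 ≤ negIf b k ↔ 0 ≤ negIf b k') := by
    intro b k k' h₁ h₂ h₃
    cases b <;> simp [negIf] <;> omega
  simp only [inputEntry, ← e₁.1]
  refine (h _).integral_conjIf_mul_congr (h' _) _ _ ?_ ?_ ?_ ?_ ?_ ?_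
  · have := natAbs_negIf (τ s).2.1 (k s); have := hk s; omega
  · have := natAbs_negIf (τ s).2.1 (k' s); have := hk' s; omega
  · simp only [natAbs_negIf, e₁.2]
  · simp only [natAbs_negIf, e₂.2]
  · exact hn _ _ _ (hk s) (hk' s) (hsign s)
  · exact hn _ _ _ (hk s') (hk' s') (hsign s')

end MixedMoment

/-! ### Null hyperplanes and Riemann sums -/

/-- A nonempty level set is a translate of the kernel, a proper subspace because it misses `v`. -/
theorem ae_linearMap_ne {ι : Type*} [Fintype ι] (L : (ι → ℝ) →ₗ[ℝ] ℝ) (v : ι → ℝ) (hv : L v ≠ 0)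
    (c : ℝ) : ∀ᵐ x : ι → ℝ, L x ≠ c := by
  rw [ae_iff]
  simp only [not_not]
  by_cases hx : ∃ x₀, L x₀ = c
  · obtain ⟨x₀, rfl⟩ := hx
    have : {x | L x = L x₀} = (fun x => -x₀ + x) ⁻¹' (LinearMap.ker L : Set (ι → ℝ)) := by
      ext x
      simp only [Set.mem_ofPred_eq, Set.mem_preimage, SetLike.mem_coe, LinearMap.mem_ker, map_add,
        map_neg]
      constructor <;> intro h <;> linarith
    rw [this, measure_preimage_add]
    refine Measure.addHaar_submodule _ _ fun htop => hv ?_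
    have : v ∈ LinearMap.ker L := htop ▸ Submodule.mem_top
    exact this
  · rw [not_exists] at hx
    simp [hx]

theorem volume_pi_Ico_floor {ι : Type*} [Fintype ι] {n : ℕ} (z : ι → ℕ) :
    volume.real (Set.univ.pi fun i => Set.Ico ((z i : ℝ) / n) ((z i + 1 : ℝ) / n)) =
      ((n : ℝ) ^ Fintype.card ι)⁻¹ := by
  rw [Measure.real, Real.volume_pi_Ico, ENNReal.toReal_prod]
  have : ∀ i, (ENNReal.ofReal ((z i + 1 : ℝ) / n - (z i : ℝ) / n)).toReal = (n : ℝ)⁻¹ := by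
    intro i
    rw [← sub_div, add_sub_cancel_left, one_div, ENNReal.toReal_ofReal (by positivity)]
  simp [this]

theorem mem_pi_Ico_floor_iff {ι : Type*} {n : ℕ} (hn : 1 ≤ n) (z : ι → ℕ) (x : ι → ℝ) :
    (x ∈ Set.univ.pi fun i => Set.Ico ((z i : ℝ) / n) ((z i + 1 : ℝ) / n)) ↔
      (∀ i, 0 ≤ x i) ∧ (fun i => ⌊n * x i⌋₊) = z := by
  have hn' : (0 : ℝ) < n := by exact_mod_cast hn
  simp only [Set.mem_univ_pi, Set.mem_Ico, funext_iff, ← forall_and]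
  refine forall_congr' fun i => ?_
  rw [div_le_iff₀ hn', lt_div_iff₀ hn', mul_comm (x i)]
  constructor
  · rintro ⟨h₁, h₂⟩
    have h0 : 0 ≤ (n : ℝ) * x i := le_trans (Nat.cast_nonneg _) h₁
    exact ⟨nonneg_of_mul_nonneg_right h0 hn', (Nat.floor_eq_iff h0).2 ⟨h₁, h₂⟩⟩
  · rintro ⟨h₁, h₂⟩
    exact (Nat.floor_eq_iff (by positivity)).1 h₂

/-- The identity is exact: the half-open cube is the disjoint union of the boxes of side `1/n` on
which the floor vector is constant. -/
theorem riemannSum_eq_integral {ι : Type*} [Fintype ι] [DecidableEq ι] {n : ℕ} (hn : 1 ≤ n)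
    (h : (ι → ℕ) → ℂ) :
    ((n : ℂ) ^ Fintype.card ι)⁻¹ * ∑ z ∈ Fintype.piFinset fun _ : ι => Finset.range n, h z =
      ∫ x in Set.univ.pi fun _ : ι => Set.Ico (0 : ℝ) 1, h fun i => ⌊n * x i⌋₊ := by
  have hn' : (0 : ℝ) < n := by exact_mod_cast hn
  set B : (ι → ℕ) → Set (ι → ℝ) := fun z =>
    Set.univ.pi fun i => Set.Ico ((z i : ℝ) / n) ((z i + 1 : ℝ) / n) with hB
  have hU : (Set.univ.pi fun _ : ι => Set.Ico (0 : ℝ) 1) =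
      ⋃ z ∈ Fintype.piFinset fun _ : ι => Finset.range n, B z := by
    ext x
    simp only [Set.mem_iUnion, exists_prop, hB, mem_pi_Ico_floor_iff hn, Fintype.mem_piFinset,
      Finset.mem_range]
    constructor
    · intro hx
      have hx' : ∀ i, 0 ≤ x i ∧ x i < 1 := fun i => hx i trivial
      refine ⟨_, fun i => ?_, fun i => (hx' i).1, rfl⟩
      rw [Nat.floor_lt (mul_nonneg hn'.le (hx' i).1)]
      nlinarith [(hx' i).2]
    · rintro ⟨z, hz, h0, rfl⟩ i -
      refine ⟨h0 i, ?_⟩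
      have := hz i
      rw [Nat.floor_lt (mul_nonneg hn'.le (h0 i))] at this
      by_contra hlt
      nlinarith
  have hmeas : ∀ z, MeasurableSet (B z) := fun z =>
    MeasurableSet.univ_pi fun i => measurableSet_Ico
  have hcongr : ∀ z, Set.EqOn (fun x : ι → ℝ => h fun i => ⌊n * x i⌋₊) (fun _ => h z) (B z) := by
    intro z x hx
    rw [hB, mem_pi_Ico_floor_iff hn] at hx
    simp only [hx.2]
  have hfin : ∀ z, volume (B z) ≠ ⊤ := by
    intro z
    simp only [hB, Real.volume_pi_Ico]
    exact ENNReal.prod_ne_top fun i _ => ENNReal.ofReal_ne_top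
  rw [hU, integral_biUnion_finset _ (fun z _ => hmeas z), Finset.mul_sum]
  · refine Finset.sum_congr rfl fun z _ => ?_
    rw [setIntegral_congr_fun (hmeas z) (hcongr z), setIntegral_const, volume_pi_Ico_floor]
    simp
  · intro z _ z' _ hne
    refine Set.disjoint_left.2 fun x hx hx' => hne ?_
    rw [hB, mem_pi_Ico_floor_iff hn] at hx hx'
    exact hx.2.symm.trans hx'.2
  · intro z _
    refine (integrableOn_congr_fun (hcongr z) (hmeas z)).2 ?_
    exact integrableOn_const (hfin z)

/-- Dominated convergence for Riemann sums over the lattice points of the unit cube. -/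
theorem tendsto_riemannSum {ι : Type*} [Fintype ι] [DecidableEq ι] (h : ℕ → (ι → ℕ) → ℂ) (C : ℝ)
    (hb : ∀ n, 1 ≤ n → ∀ z, ‖h n z‖ ≤ C) (g : (ι → ℝ) → ℂ)
    (hlim : ∀ᵐ x : ι → ℝ, (∀ i, 0 ≤ x i ∧ x i < 1) →
      Tendsto (fun n : ℕ => h n fun i => ⌊n * x i⌋₊) atTop (𝓝 (g x))) :
    Tendsto (fun n : ℕ => ((n : ℂ) ^ Fintype.card ι)⁻¹ *
        ∑ z ∈ Fintype.piFinset fun _ : ι => Finset.range n, h n z) atTop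
      (𝓝 (∫ x in Set.univ.pi fun _ : ι => Set.Ico (0 : ℝ) 1, g x)) := by
  have hU : MeasurableSet (Set.univ.pi fun _ : ι => Set.Ico (0 : ℝ) 1) :=
    MeasurableSet.univ_pi fun i => measurableSet_Ico
  have hfin : volume (Set.univ.pi fun _ : ι => Set.Ico (0 : ℝ) 1) ≠ ⊤ := by
    rw [Real.volume_pi_Ico]
    exact ENNReal.prod_ne_top fun i _ => ENNReal.ofReal_ne_top
  have : Tendsto (fun n : ℕ => ∫ x in Set.univ.pi fun _ : ι => Set.Ico (0 : ℝ) 1,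
      h n fun i => ⌊n * x i⌋₊) atTop
      (𝓝 (∫ x in Set.univ.pi fun _ : ι => Set.Ico (0 : ℝ) 1, g x)) := by
    refine tendsto_integral_filter_of_dominated_convergence (fun _ => C) ?_ ?_ ?_ ?_
    · refine Eventually.of_forall fun n => ?_
      have : Measurable fun (x : ι → ℝ) (i : ι) => ⌊n * x i⌋₊ := by fun_prop
      exact ((Measurable.of_discrete (f := h n)).comp this).aestronglyMeasurable
    · filter_upwards [eventually_ge_atTop 1] with n hn
      exact Eventually.of_forall fun x => hb n hn _
    · exact integrableOn_const hfin
    · rw [ae_restrict_iff' hU]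
      filter_upwards [hlim] with x hx hmem
      exact hx fun i => hmem i trivial
  refine this.congr' ?_
  filter_upwards [eventually_ge_atTop 1] with n hn
  exact (riemannSum_eq_integral hn _).symm

/-! ### Products of Toeplitz matrices as sums over lattice paths -/

/-- The sum of the `κ t` with `t < s`. -/
def partialSum {r : ℕ} (κ : Fin r → ℤ) (s : Fin r) : ℤ := ∑ t, if t < s then κ t else 0

/-- The path that starts at `i` and makes the steps `-κ s` stays in `[0, n)` and ends at `i`, or
at its mirror image if `e` holds. -/
def IsClosedPath (n : ℕ) (e : Bool) {r : ℕ} (κ : Fin r → ℤ) (i : ℤ) : Prop :=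
  (∀ s, 0 ≤ i - partialSum κ s ∧ i - partialSum κ s < n) ∧
    i - ∑ s, κ s = if e then n - 1 - i else i

/-- The backward identity if `b` holds, and the identity otherwise. -/
def flipMatrix (n : ℕ) (b : Bool) : Matrix (Fin n) (Fin n) ℂ :=
  if b then backwardIdentity n else 1

/-- The `n × n` matrix of the shift by `k`. -/
def shiftMatrix (n : ℕ) (k : ℤ) : Matrix (Fin n) (Fin n) ℂ := toeplitz n (Pi.single k 1)

theorem shiftMatrix_apply (n : ℕ) (k : ℤ) (i j : Fin n) :
    shiftMatrix n k i j = if (i : ℤ) - j = k then 1 else 0 := by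
  simp [shiftMatrix, toeplitz, Pi.single_apply]

theorem toeplitz_single_zero (n : ℕ) : toeplitz n (Pi.single 0 1) = 1 := by
  ext i j
  rw [← shiftMatrix, shiftMatrix_apply, Matrix.one_apply]
  refine if_congr ?_ rfl rfl
  rw [sub_eq_zero, Nat.cast_inj, Fin.val_inj]

theorem toeplitz_eq_sum (n : ℕ) (b : ℤ → ℂ) :
    toeplitz n b = ∑ k ∈ Finset.Ioo (-n : ℤ) n, b k • shiftMatrix n k := by
  ext i j
  rw [Matrix.sum_apply, Finset.sum_eq_single ((i : ℤ) - j)]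
  · simp [shiftMatrix_apply, toeplitz]
  · intro k _ hk
    simp [shiftMatrix_apply, hk.symm]
  · intro hk
    have := i.2
    have := j.2
    exact absurd (Finset.mem_Ioo.2 ⟨by omega, by omega⟩) hk

theorem partialSum_cons_zero {r : ℕ} (κ : Fin (r + 1) → ℤ) : partialSum κ 0 = 0 := by
  simp [partialSum]

theorem partialSum_succ {r : ℕ} (κ : Fin (r + 1) → ℤ) (s : Fin r) :
    partialSum κ s.succ = κ 0 + partialSum (fun t => κ t.succ) s := by
  simp [partialSum, Fin.sum_univ_succ]

/-- A shift by `k` moves the row index `i` to `i - k`. The product is therefore the indicator that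
all positions along the path are admissible and that the last one is `j`. -/
theorem prod_shiftMatrix_apply (n : ℕ) {r : ℕ} (κ : Fin r → ℤ) (i j : Fin n) :
    (List.ofFn fun s => shiftMatrix n (κ s)).prod i j =
      open scoped Classical in
      if (∀ s, 0 ≤ (i : ℤ) - partialSum κ s ∧ (i : ℤ) - partialSum κ s < n) ∧
        (i : ℤ) - ∑ s, κ s = j then 1 else 0 := by
  classical
  induction r generalizing i with
  | zero =>
    simp only [List.ofFn_zero, List.prod_nil, Matrix.one_apply, IsEmpty.forall_iff, true_and,
      Finset.univ_eq_empty, Finset.sum_empty, sub_zero, Nat.cast_inj, Fin.val_inj]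
  | succ r ih =>
    rw [List.ofFn_succ, List.prod_cons, Matrix.mul_apply]
    simp only [ih, shiftMatrix_apply, ite_mul, one_mul, zero_mul, ← ite_and]
    simp only [Fin.forall_fin_succ, partialSum_cons_zero, partialSum_succ, Fin.sum_univ_succ,
      sub_zero]
    have hi := i.2
    have hj := j.2
    by_cases hr : 0 ≤ (i : ℤ) - κ 0 ∧ (i : ℤ) - κ 0 < n
    · rw [Finset.sum_eq_single (⟨((i : ℤ) - κ 0).toNat, by omega⟩ : Fin n)]
      · have e : ((((i : ℤ) - κ 0).toNat : ℕ) : ℤ) = i - κ 0 := by omega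
        simp only [e]
        refine if_congr ?_ rfl rfl
        constructor
        · rintro ⟨-, h₁, h₂⟩
          refine ⟨⟨⟨by omega, by omega⟩, fun s => ?_⟩, by omega⟩
          have := h₁ s
          omega
        · rintro ⟨⟨-, h₁⟩, h₂⟩
          refine ⟨by omega, fun s => ?_, by omega⟩
          have := h₁ s
          omega
      · intro b _ hb
        refine if_neg fun h => hb ?_
        ext
        simp only
        omega
      · simp
    -- If the first step leaves `[0, n)`, no path survives: that position is either the endpoint `j`
    -- or the position checked before the next letter.
    · rw [Finset.sum_eq_zero, if_neg]
      · rintro ⟨⟨-, h₁⟩, h₂⟩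
        apply hr
        cases r with
        | zero =>
          simp only [Finset.univ_eq_empty, Finset.sum_empty] at h₂
          omega
        | succ r =>
          have := h₁ 0
          rw [partialSum_cons_zero] at this
          omega
      · intro b _
        refine if_neg fun h => hr ?_
        have := b.2
        omega

theorem mul_backwardIdentity_apply {n : ℕ} (A : Matrix (Fin n) (Fin n) ℂ) (i j : Fin n) :
    (A * backwardIdentity n) i j = A i j.rev := by
  rw [Matrix.mul_apply, Finset.sum_eq_single j.rev]
  · simp [backwardIdentity]
  · intro k _ hk
    simp [backwardIdentity, hk]
  · simp

open scoped Classical in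
theorem trace_prod_toeplitz (n : ℕ) {r : ℕ} (B : Fin r → ℤ → ℂ) (e : Bool) :
    ((List.ofFn fun s => toeplitz n (B s)).prod * flipMatrix n e).trace =
      ∑ κ ∈ Fintype.piFinset fun _ : Fin r => Finset.Ioo (-n : ℤ) n, (∏ s, B s (κ s)) *
        ∑ i ∈ Finset.range n, if IsClosedPath n e κ i then 1 else 0 := by
  have expand : (List.ofFn fun s => toeplitz n (B s)).prod =
      ∑ κ ∈ Fintype.piFinset fun _ : Fin r => Finset.Ioo (-n : ℤ) n,
        (∏ s, B s (κ s)) • (List.ofFn fun s => shiftMatrix n (κ s)).prod := by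
    have := (MultilinearMap.mkPiAlgebraFin ℂ r (Matrix (Fin n) (Fin n) ℂ)).map_sum_finset
      (fun s k => B s k • shiftMatrix n k) (fun _ => Finset.Ioo (-n : ℤ) n)
    simp only [MultilinearMap.map_smul_univ, MultilinearMap.mkPiAlgebraFin_apply,
      ← toeplitz_eq_sum] at this
    exact this
  rw [expand, Finset.sum_mul, Matrix.trace_sum]
  refine Finset.sum_congr rfl fun κ _ => ?_
  rw [smul_mul_assoc, Matrix.trace_smul, smul_eq_mul]
  congr 1
  rw [Matrix.trace, Finset.sum_range]
  refine Finset.sum_congr rfl fun i _ => ?_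
  rw [Matrix.diag_apply]
  have hi := i.2
  cases e
  · simp only [flipMatrix, Bool.false_eq_true, if_false, mul_one, prod_shiftMatrix_apply,
      IsClosedPath]
  · simp only [flipMatrix, if_true, mul_backwardIdentity_apply, prod_shiftMatrix_apply,
      IsClosedPath]
    refine if_congr (and_congr_right fun _ => ?_) rfl rfl
    rw [Fin.val_rev]
    omega

/-! ### Moving the backward identities to the right -/

theorem star_toeplitz (n : ℕ) (b : ℤ → ℂ) :
    star (toeplitz n b) = toeplitz n fun k => star (b (-k)) := by
  ext i j
  simp [toeplitz, Matrix.star_apply]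

theorem backwardIdentity_mul_apply {n : ℕ} (A : Matrix (Fin n) (Fin n) ℂ) (i j : Fin n) :
    (backwardIdentity n * A) i j = A i.rev j := by
  rw [Matrix.mul_apply, Finset.sum_eq_single i.rev]
  · simp [backwardIdentity]
  · intro k _ hk
    have : i ≠ k.rev := fun h => hk (by rw [h, Fin.rev_rev])
    simp [backwardIdentity, this]
  · simp

theorem backwardIdentity_mul_self (n : ℕ) : backwardIdentity n * backwardIdentity n = 1 := by
  ext i j
  rw [backwardIdentity_mul_apply]
  simp [backwardIdentity, Matrix.one_apply]

theorem star_backwardIdentity (n : ℕ) : star (backwardIdentity n) = backwardIdentity n := by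
  ext i j
  have : j = i.rev ↔ i = j.rev :=
    ⟨fun h => by rw [h, Fin.rev_rev], fun h => by rw [h, Fin.rev_rev]⟩
  simp only [backwardIdentity, Matrix.star_apply, Matrix.of_apply, this]
  split_ifs <;> simp

/-- Reversing both indices turns `i - j` into `j - i`. -/
theorem backwardIdentity_mul_toeplitz (n : ℕ) (b : ℤ → ℂ) :
    backwardIdentity n * toeplitz n b = toeplitz n (fun k => b (-k)) * backwardIdentity n := by
  ext i j
  rw [backwardIdentity_mul_apply, mul_backwardIdentity_apply]
  simp only [toeplitz, Matrix.of_apply, Fin.val_rev]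
  congr 1
  have := i.2
  have := j.2
  omega

theorem flipMatrix_mul_toeplitz (n : ℕ) (e : Bool) (b : ℤ → ℂ) :
    flipMatrix n e * toeplitz n b = toeplitz n (fun k => b (negIf e k)) * flipMatrix n e := by
  cases e
  · simp [flipMatrix, negIf]
  · simpa [flipMatrix, negIf] using backwardIdentity_mul_toeplitz n b

theorem flipMatrix_mul_backwardIdentity (n : ℕ) (e : Bool) :
    flipMatrix n e * backwardIdentity n = flipMatrix n (!e) := by
  cases e <;> simp [flipMatrix, backwardIdentity_mul_self]

/-- The letters of a word together with their stars and the parities of the numbers of letters `P`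
to their left, counted from the initial parity `b`. -/
def annotate {m : ℕ} : Bool → List (Letter m × Bool) → List (Letter m × Bool × Bool)
  | _, [] => []
  | b, x :: w => (x.1, x.2, b) :: annotate (xor b x.1.isP) w

/-- The parity of the number of letters `P`, counted from the initial parity `b`. -/
def finalFlip {m : ℕ} : Bool → List (Letter m × Bool) → Bool
  | b, [] => b
  | b, x :: w => finalFlip (xor b x.1.isP) w

theorem finalFlip_eq {m : ℕ} (b : Bool) (w : List (Letter m × Bool)) :
    finalFlip b w = xor b (decide (Odd (w.countP fun p => p.1.isP))) := by
  induction w generalizing b with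
  | nil => simp [finalFlip]
  | cons x w ih =>
    rw [finalFlip, ih, List.countP_cons]
    cases x.1.isP <;> cases b <;> simp [Nat.odd_add_one, -Nat.not_odd_iff_even]

theorem countP_annotate {m : ℕ} (b : Bool) (w : List (Letter m × Bool)) (f : Letter m → Bool) :
    (annotate b w).countP (fun p => f p.1) = w.countP fun p => f p.1 := by
  induction w generalizing b with
  | nil => rfl
  | cons x w ih => rw [annotate, List.countP_cons, List.countP_cons, ih]

/-- The input sequence of the Toeplitz matrix that represents an annotated letter; letters `P` and
letters that are not kept are represented by the identity. -/
noncomputable def letterSeq {m : ℕ} {Ω : Type*} (n : ℕ) (a : Fin m → ℤ → Ω → ℂ)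
    (d : Fin m → ℤ → ℂ) (keep : Letter m → Bool) (ω : Ω) : Letter m × Bool × Bool → ℤ → ℂ
  | (.P, _, _) => Pi.single 0 1
  | (.T i, s, b) => if keep (.T i) then
      fun k => (((Real.sqrt n)⁻¹ : ℝ) : ℂ) * inputEntry a (i, xor s b, s) k ω else Pi.single 0 1
  | (.D i, s, b) => if keep (.D i) then
      fun k => conjIf s (d i (negIf (xor s b) k)) else Pi.single 0 1

/-- All words obtained by deleting letters other than `P` are written with the annotation of the
full word, a deleted letter becoming an identity factor. Their limits can then be compared factor by
factor. -/
theorem flipMatrix_mul_starMonomial {m : ℕ} {Ω : Type*} (n : ℕ) (a : Fin m → ℤ → Ω → ℂ)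
    (d : Fin m → ℤ → ℂ) (keep : Letter m → Bool) (hP : keep .P = true) (ω : Ω) (b : Bool)
    (w : List (Letter m × Bool)) :
    flipMatrix n b * starMonomial (fun i => modelMatrix n a d i ω) (w.filter fun p => keep p.1) =
      ((annotate b w).map fun u => toeplitz n (letterSeq n a d keep ω u)).prod *
        flipMatrix n (finalFlip b w) := by
  induction w generalizing b with
  | nil => simp [starMonomial, annotate, finalFlip]
  | cons x w ih =>
    have hcons : ∀ (x : Letter m × Bool) (v : List (Letter m × Bool)),
        starMonomial (fun i => modelMatrix n a d i ω) (x :: v) =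
          (if x.2 then star (modelMatrix n a d x.1 ω) else modelMatrix n a d x.1 ω) *
          starMonomial (fun i => modelMatrix n a d i ω) v := fun x v => by simp [starMonomial]
    obtain ⟨l, s⟩ := x
    rw [annotate, finalFlip, List.map_cons, List.prod_cons, mul_assoc, ← ih, List.filter_cons]
    simp only
    cases l with
    | P =>
      simp only [hP, if_true, hcons, Letter.isP, letterSeq, toeplitz_single_zero, one_mul,
        Bool.xor_true]
      simp only [show modelMatrix n a d .P ω = backwardIdentity n from rfl, star_backwardIdentity,
        ite_self]
      rw [← mul_assoc, flipMatrix_mul_backwardIdentity]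
    | T i =>
      simp only [Letter.isP, Bool.xor_false]
      by_cases hk : keep (.T i)
      · simp only [hk, if_true, hcons, letterSeq]
        rw [← mul_assoc, ← mul_assoc]
        congr 1
        have : (if s then star (modelMatrix n a d (.T i) ω) else modelMatrix n a d (.T i) ω) =
            toeplitz n fun k => (((Real.sqrt n)⁻¹ : ℝ) : ℂ) * inputEntry a (i, s, s) k ω := by
          have hs : (((Real.sqrt n)⁻¹ : ℝ) : ℂ) • toeplitz n (fun j => a i j ω) =
              toeplitz n fun k => (((Real.sqrt n)⁻¹ : ℝ) : ℂ) * a i k ω := by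
            ext; simp [toeplitz]
          simp only [modelMatrix, hs, star_toeplitz]
          cases s <;> simp [inputEntry, conjIf, negIf]
        -- An adjoint reflects the index as well as conjugating, so the total reflection is `xor s
        -- b`.
        rw [this, flipMatrix_mul_toeplitz]
        congr 2
        ext k
        cases s <;> cases b <;> simp [inputEntry, negIf]
      · simp only [hk, if_false, letterSeq, toeplitz_single_zero, one_mul, Bool.false_eq_true]
    | D i =>
      simp only [Letter.isP, Bool.xor_false]
      by_cases hk : keep (.D i)
      · simp only [hk, if_true, hcons, letterSeq]
        rw [← mul_assoc, ← mul_assoc]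
        congr 1
        have : (if s then star (modelMatrix n a d (.D i) ω) else modelMatrix n a d (.D i) ω) =
            toeplitz n fun k => conjIf s (d i (negIf s k)) := by
          simp only [modelMatrix, star_toeplitz]
          cases s <;> simp [conjIf, negIf]
        rw [this, flipMatrix_mul_toeplitz]
        congr 2
        ext k
        cases s <;> cases b <;> simp [negIf]
      · simp only [hk, if_false, letterSeq, toeplitz_single_zero, one_mul, Bool.false_eq_true]

/-! ### Patterns of coincidences among the random entries -/

noncomputable instance Setoid.instFintype {T : Type*} [Finite T] : Fintype (Setoid T) :=
  have : Finite (Setoid T) :=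
    Finite.of_injective (fun (S : Setoid T) (s s' : T) => S s s') fun _ _ h =>
      Setoid.ext fun s s' => iff_of_eq (congrFun (congrFun h s) s')
  Fintype.ofFinite _

/-- The entry indices with absolute values `z`, constant on the classes of `S`, and signs `σ`. -/
def signedPoint {T : Type*} (S : Setoid T) (σ : T → Bool) (z : Option (Quotient S) → ℕ) (s : T) :
    ℤ :=
  negIf (σ s) (z (some (Quotient.mk S s)))

/-- The entries with indices `k` coincide as prescribed by `S` and have the signs `σ`. -/
def IsPattern {m : ℕ} {T : Type*} (τ : T → Fin m × Bool × Bool) (S : Setoid T) (σ : T → Bool)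
    (k : T → ℤ) : Prop :=
  Setoid.ker (entryKey τ k) = S ∧ (fun s => decide (k s < 0)) = σ

theorem natAbs_signedPoint {T : Type*} (S : Setoid T) (σ : T → Bool) (z : Option (Quotient S) → ℕ)
    (s : T) : (signedPoint S σ z s).natAbs = z (some (Quotient.mk S s)) := by
  rw [signedPoint, natAbs_negIf, Int.natAbs_natCast]

open scoped Classical in
-- A pattern leaves one absolute value per class free; the coordinate `none` carries the start of
-- the path. Demanding that the signed point have exactly the pattern `(S, σ)` makes every index
-- family occur once; a zero index counts as nonnegative.
theorem sum_eq_sum_patterns {m : ℕ} {T : Type*} [Fintype T] [DecidableEq T]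
    (τ : T → Fin m × Bool × Bool) (n : ℕ)
    (F : (T → ℤ) → ℕ → ℂ) :
    ∑ k ∈ Fintype.piFinset fun _ : T => Finset.Ioo (-n : ℤ) n, ∑ i ∈ Finset.range n, F k i =
      ∑ S : Setoid T, ∑ σ : T → Bool,
        ∑ z ∈ Fintype.piFinset fun _ : Option (Quotient S) => Finset.range n,
          if IsPattern τ S σ (signedPoint S σ z) then F (signedPoint S σ z) (z none) else 0 := by
  have hfib : ∑ k ∈ Fintype.piFinset fun _ : T => Finset.Ioo (-n : ℤ) n,
      ∑ i ∈ Finset.range n, F k i = ∑ S : Setoid T, ∑ σ : T → Bool,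
        ∑ x ∈ ((Fintype.piFinset fun _ : T => Finset.Ioo (-n : ℤ) n) ×ˢ Finset.range n).filter
          (fun x => IsPattern τ S σ x.1), F x.1 x.2 := by
    rw [← Finset.sum_product', ← Finset.sum_fiberwise _
      (fun x => (Setoid.ker (entryKey τ x.1), fun s => decide (x.1 s < 0))),
      Fintype.sum_prod_type]
    simp only [Prod.mk.injEq]
    refine Finset.sum_congr rfl fun _ _ => Finset.sum_congr rfl fun _ _ => ?_
    refine Finset.sum_congr ?_ fun _ _ => rfl
    ext
    simp only [Finset.mem_filter]
    exact Iff.rfl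
  rw [hfib]
  refine Finset.sum_congr rfl fun S _ => Finset.sum_congr rfl fun σ _ => ?_
  rw [← Finset.sum_filter]
  have hinv : ∀ k : T → ℤ, IsPattern τ S σ k → ∀ i : ℕ,
      signedPoint S σ (fun o => o.elim i fun q => (k q.out).natAbs) = k := by
    intro k hk i
    ext s
    have h₁ : Setoid.ker (entryKey τ k) (Quotient.mk S s).out s := by
      rw [hk.1]
      exact Quotient.exact (Quotient.out_eq _)
    have h₂ : (k (Quotient.mk S s).out).natAbs = (k s).natAbs := (Prod.mk.inj h₁).2
    have h₃ : decide (k s < 0) = σ s := congrFun hk.2 s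
    simp only [signedPoint, Option.elim_some, h₂, ← h₃, negIf, decide_eq_true_eq]
    split_ifs <;> omega
  refine Finset.sum_bij' (fun x _ => fun o => o.elim x.2 fun q => (x.1 q.out).natAbs)
    (fun z _ => (signedPoint S σ z, z none)) ?_ ?_ ?_ ?_ ?_
  · rintro ⟨k, i⟩ hx
    simp only [Finset.mem_filter, Finset.mem_product, Fintype.mem_piFinset, Finset.mem_Ioo,
      Finset.mem_range] at hx ⊢
    refine ⟨fun o => ?_, ?_⟩
    · cases o with
      | none => exact hx.1.2
      | some q =>
        have := hx.1.1 q.out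
        simp only [Option.elim_some]
        omega
    · rw [hinv k hx.2]
      exact hx.2
  · intro z hz
    simp only [Finset.mem_filter, Finset.mem_product, Fintype.mem_piFinset, Finset.mem_Ioo,
      Finset.mem_range] at hz ⊢
    refine ⟨⟨fun s => ?_, hz.1 none⟩, hz.2⟩
    have h₁ := natAbs_signedPoint S σ z s
    have h₂ := hz.1 (some (Quotient.mk S s))
    omega
  · rintro ⟨k, i⟩ hx
    simp only [Finset.mem_filter] at hx
    simp only [Prod.mk.injEq]
    exact ⟨hinv k hx.2 i, rfl⟩
  · intro z hz
    ext o
    cases o with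
    | none => rfl
    | some q =>
      simp only [Option.elim_some]
      rw [natAbs_signedPoint, Quotient.out_eq]
  · rintro ⟨k, i⟩ hx
    simp only [Finset.mem_filter] at hx
    rw [hinv k hx.2 i]
    rfl

/-! ### Combining random and deterministic steps; asymptotic signs -/

/-- The family on `Fin r` with parts `k` and `l` on the two sides of the predicate `p`. -/
def glue {r : ℕ} (p : Fin r → Prop) [DecidablePred p] (k : {s // p s} → ℤ) (l : {s // ¬ p s} → ℤ)
    (s : Fin r) : ℤ :=
  if h : p s then k ⟨s, h⟩ else l ⟨s, h⟩

theorem sum_glue {r : ℕ} (p : Fin r → Prop) [DecidablePred p] (k : {s // p s} → ℤ)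
    (l : {s // ¬ p s} → ℤ) : ∑ s, glue p k l s = ∑ s, k s + ∑ s, l s := by
  rw [← Fintype.sum_subtype_add_sum_subtype p]
  congr 1
  · exact Finset.sum_congr rfl fun s _ => by simp [glue, s.2]
  · exact Finset.sum_congr rfl fun s _ => by simp [glue, s.2]

/-- Integer path conditions are decided by the sign of a nonzero limit. Weak and strict inequalities
and any fixed `c` make no difference, so boundary effects disappear. -/
theorem eventually_sign {u : ℕ → ℤ} {y : ℝ} (hu : Tendsto (fun n => (u n : ℝ) / n) atTop (𝓝 y))
    (hy : y ≠ 0) (c : ℤ) :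
    ∀ᶠ n in atTop, (0 ≤ u n ↔ 0 < y) ∧ (0 < u n ↔ 0 < y) ∧ u n ≠ c := by
  have hc : Tendsto (fun n : ℕ => ((u n : ℝ) - c) / n) atTop (𝓝 y) := by
    have := hu.sub (tendsto_const_div_atTop_nhds_zero_nat (c : ℝ))
    simpa only [sub_zero, ← sub_div] using this
  rcases lt_or_gt_of_ne hy with h | h
  · filter_upwards [hu.eventually_lt_const h, hc.eventually_lt_const h, eventually_gt_atTop 0]
      with n h₁ h₂ hn
    have hn' : (0 : ℝ) < n := by exact_mod_cast hn
    rw [div_lt_iff₀ hn', zero_mul] at h₁ h₂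
    have h₁' : u n < 0 := by exact_mod_cast h₁
    have h₂' : u n < c := by exact_mod_cast sub_neg.1 h₂
    refine ⟨?_, ?_, h₂'.ne⟩ <;> constructor <;> intro <;> linarith
  · filter_upwards [hu.eventually_const_lt h, hc.eventually_const_lt h, eventually_gt_atTop 0]
      with n h₁ h₂ hn
    have hn' : (0 : ℝ) < n := by exact_mod_cast hn
    rw [lt_div_iff₀ hn', zero_mul] at h₁ h₂
    have h₁' : 0 < u n := by exact_mod_cast h₁
    have h₂' : c < u n := by exact_mod_cast sub_pos.1 h₂
    exact ⟨⟨fun _ => h, fun _ => h₁'.le⟩, ⟨fun _ => h, fun _ => h₁'⟩, h₂'.ne'⟩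

theorem tendsto_floor_mul_div {x : ℝ} (hx : 0 ≤ x) :
    Tendsto (fun n : ℕ => ((⌊n * x⌋₊ : ℕ) : ℝ) / n) atTop (𝓝 x) := by
  have := (tendsto_nat_floor_mul_div_atTop hx).comp (tendsto_natCast_atTop_atTop (R := ℝ))
  simpa only [Function.comp_def, mul_comm x] using this

/-! ### Linear forms of the rescaled path -/

section Forms

variable {r : ℕ} (p : Fin r → Prop) [DecidablePred p] (S : Setoid {s // p s})
  (σ : {s // p s} → Bool)

/-- The rescaled step of the path at the letter `s`. -/
def stepForm (s : Fin r) : (Option (Quotient S) → ℝ) →ₗ[ℝ] ℝ :=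
  if h : p s then (if σ ⟨s, h⟩ then (-1 : ℝ) else 1) •
    LinearMap.proj (some (Quotient.mk S ⟨s, h⟩)) else 0

/-- The rescaled position of the path before the letter `s`. -/
def positionForm (s : Fin r) : (Option (Quotient S) → ℝ) →ₗ[ℝ] ℝ :=
  LinearMap.proj none - ∑ t, if t < s then stepForm p S σ t else 0

theorem stepForm_single_none [DecidableEq (Quotient S)] (s : Fin r) :
    stepForm p S σ s (Pi.single none 1) = 0 := by
  rw [stepForm]
  split_ifs <;> simp

theorem positionForm_single_none [DecidableEq (Quotient S)] (s : Fin r) :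
    positionForm p S σ s (Pi.single none 1) = 1 := by
  have : ∀ t, (if t < s then stepForm p S σ t else 0) (Pi.single none 1) = 0 := by
    intro t
    split_ifs
    · exact stepForm_single_none p S σ t
    · rfl
  simp [positionForm, LinearMap.sum_apply, this]

theorem tendsto_step (l : {s // ¬ p s} → ℤ) {x : Option (Quotient S) → ℝ} (hx : ∀ o, 0 ≤ x o)
    (s : Fin r) :
    Tendsto (fun n : ℕ =>
      ((glue p (signedPoint S σ fun o => ⌊n * x o⌋₊) l s : ℤ) : ℝ) / n) atTop
      (𝓝 (stepForm p S σ s x)) := by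
  by_cases h : p s
  · have := tendsto_floor_mul_div (hx (some (Quotient.mk S ⟨s, h⟩)))
    simp only [glue, h, dif_pos, signedPoint, stepForm, negIf]
    cases σ ⟨s, h⟩
    · simpa using this
    · simpa [neg_div] using this.neg
  · simp only [glue, h, stepForm, dif_neg, not_false_eq_true, LinearMap.zero_apply]
    exact tendsto_const_div_atTop_nhds_zero_nat _

/-- The deterministic steps are fixed integers, so they vanish after division by `n`. -/
theorem tendsto_position (l : {s // ¬ p s} → ℤ) {x : Option (Quotient S) → ℝ}
    (hx : ∀ o, 0 ≤ x o) (s : Fin r) :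
    Tendsto (fun n : ℕ => (((⌊n * x none⌋₊ : ℕ) -
      partialSum (glue p (signedPoint S σ fun o => ⌊n * x o⌋₊) l) s : ℤ) : ℝ) / n) atTop
      (𝓝 (positionForm p S σ s x)) := by
  have h₁ : Tendsto (fun n : ℕ => ((partialSum (glue p (signedPoint S σ
      fun o => ⌊n * x o⌋₊) l) s : ℤ) : ℝ) / n) atTop
      (𝓝 (∑ t, (if t < s then stepForm p S σ t else 0) x)) := by
    simp only [partialSum, Int.cast_sum, Finset.sum_div]
    refine tendsto_finsetSum _ fun t _ => ?_
    by_cases hts : t < s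
    · simp only [hts, if_true]
      exact tendsto_step p S σ l hx t
    · simp [hts]
  have := (tendsto_floor_mul_div (hx none)).sub h₁
  simpa only [Int.cast_sub, Int.cast_natCast, sub_div, positionForm, LinearMap.sub_apply,
    LinearMap.proj_apply, LinearMap.sum_apply] using this

theorem tendsto_total (l : {s // ¬ p s} → ℤ) {x : Option (Quotient S) → ℝ}
    (hx : ∀ o, 0 ≤ x o) :
    Tendsto (fun n : ℕ => ((∑ s, glue p (signedPoint S σ fun o => ⌊n * x o⌋₊) l s : ℤ) : ℝ) / n)
      atTop (𝓝 ((∑ s, stepForm p S σ s) x)) := by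
  simp only [Int.cast_sum, Finset.sum_div, LinearMap.sum_apply]
  exact tendsto_finsetSum _ fun t _ => tendsto_step p S σ l hx t

/-- The identity of linear forms is evaluated at the integer point `z`, with zero deterministic
steps. -/
theorem sum_signedPoint_eq_zero (h : ∑ s, stepForm p S σ s = 0)
    (z : Option (Quotient S) → ℕ) : ∑ s, signedPoint S σ z s = 0 := by
  have h₁ := congrArg (fun L => L fun o => (z o : ℝ)) h
  simp only [LinearMap.sum_apply, LinearMap.zero_apply] at h₁
  have h₂ : ((∑ s, glue p (signedPoint S σ z) (fun _ => 0) s : ℤ) : ℝ) = 0 := by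
    rw [← h₁, Int.cast_sum]
    refine Finset.sum_congr rfl fun s _ => ?_
    by_cases hs : p s
    · simp only [glue, stepForm, hs, dif_pos, signedPoint, negIf]
      cases σ ⟨s, hs⟩ <;> simp
    · simp [glue, stepForm, hs]
  rw [sum_glue, Finset.sum_const_zero, add_zero] at h₂
  exact_mod_cast h₂

end Forms

/-- With distinct positive absolute values, the kernel and the signs come out as prescribed unless a
class mixes entries of different copies. -/
theorem isPattern_signedPoint_iff {m : ℕ} {T : Type*} {τ : T → Fin m × Bool × Bool}
    {S : Setoid T} {σ : T → Bool} {z : Option (Quotient S) → ℕ}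
    (hinj : ∀ q q' : Quotient S, z (some q) = z (some q') → q = q')
    (hpos : ∀ q : Quotient S, 0 < z (some q)) :
    IsPattern τ S σ (signedPoint S σ z) ↔ ∀ s s', S s s' → (τ s).1 = (τ s').1 := by
  constructor
  · rintro ⟨h, -⟩ s s' hs
    rw [← h] at hs
    exact (Prod.mk.inj hs).1
  · refine fun h => ⟨Setoid.ext fun s s' => ?_, funext fun s => ?_⟩
    · simp only [Setoid.ker_def, entryKey, natAbs_signedPoint, Prod.mk.injEq]
      exact ⟨fun h' => Quotient.exact (hinj _ _ h'.2),
        fun h' => ⟨h s s' h', by rw [Quotient.sound h']⟩⟩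
    · have := hpos (Quotient.mk S s)
      cases hσ : σ s
      · simp [signedPoint, negIf, hσ]
      · simp [signedPoint, negIf, hσ, this]

open scoped Classical in
-- Every class has at least two elements; equality in the count forces exactly two. Thus pairings
-- are the patterns of maximal dimension.
theorem two_mul_card_quotient_le {T : Type*} [Fintype T] {S : Setoid T}
    (hns : ∀ s, ∃ s', S s' s ∧ s' ≠ s) :
    2 * Fintype.card (Quotient S) ≤ Fintype.card T ∧
      (2 * Fintype.card (Quotient S) = Fintype.card T →
        ∀ s, (Finset.univ.filter fun s' => S s' s).card = 2) := by
  have hsum : Fintype.card T = ∑ q : Quotient S,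
      (Finset.univ.filter fun s => Quotient.mk S s = q).card :=
    Finset.card_eq_sum_card_fiberwise fun _ _ => Finset.mem_coe.2 (Finset.mem_univ _)
  have hle : ∀ q ∈ (Finset.univ : Finset (Quotient S)),
      2 ≤ (Finset.univ.filter fun s => Quotient.mk S s = q).card := by
    intro q _
    obtain ⟨s, rfl⟩ := Quotient.exists_rep q
    obtain ⟨s', hs', hne⟩ := hns s
    refine Finset.one_lt_card.2 ⟨s', ?_, s, ?_, hne⟩
    · simpa using Quotient.sound hs'
    · simp
  have hconst : 2 * Fintype.card (Quotient S) = ∑ _q : Quotient S, 2 := by simp [mul_comm]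
  refine ⟨by rw [hsum, hconst]; exact Finset.sum_le_sum hle, fun h s => ?_⟩
  rw [hsum, hconst, Finset.sum_eq_sum_iff_of_le hle] at h
  rw [h (Quotient.mk S s) (Finset.mem_univ _)]
  congr 1
  ext s'
  simp only [Finset.mem_filter, Finset.mem_univ, true_and, Quotient.eq]

/-! ### Limit of the contribution of one pattern -/

section Pattern

variable {m r : ℕ} {p : Fin r → Prop} [DecidablePred p] {τ : {s // p s} → Fin m × Bool × Bool}
  {S : Setoid {s // p s}} {σ : {s // p s} → Bool}

open scoped Classical in
/-- The properties of the mixed moments on which the limit depends: they are bounded, vanish if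
some entry is independent of all others, and in the paired case depend on the pattern only. -/
structure IsPairedMoment (τ : {s // p s} → Fin m × Bool × Bool) (M : ℕ → ({s // p s} → ℤ) → ℂ)
    (C : ℝ) : Prop where
  bound : ∀ n, 1 ≤ n → ∀ k, ‖M n k‖ ≤ C
  zero : ∀ n, 1 ≤ n → ∀ k s, (∀ s', entryKey τ k s' = entryKey τ k s → s' = s) → M n k = 0
  congr : ∀ n n', 1 ≤ n → 1 ≤ n' → ∀ k k',
    Setoid.ker (entryKey τ k) = Setoid.ker (entryKey τ k') →
    (∀ s, (Finset.univ.filter fun s' => entryKey τ k s' = entryKey τ k s).card = 2) →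
    (∀ s, k s ≠ 0) → (∀ s, k' s ≠ 0) → (∀ s, 0 ≤ k s ↔ 0 ≤ k' s) → M n k = M n' k'

open scoped Classical in
/-- The contribution of one lattice point to the moment. -/
noncomputable def patternTerm (τ : {s // p s} → Fin m × Bool × Bool)
    (M : ℕ → ({s // p s} → ℤ) → ℂ) (e : Bool) (S : Setoid {s // p s}) (σ : {s // p s} → Bool)
    (l : {s // ¬ p s} → ℤ) (n : ℕ) (z : Option (Quotient S) → ℕ) : ℂ :=
  if IsPattern τ S σ (signedPoint S σ z) then M n (signedPoint S σ z) *
    (if IsClosedPath n e (glue p (signedPoint S σ z) l) (z none) then 1 else 0) else 0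

variable {M : ℕ → ({s // p s} → ℤ) → ℂ} {C : ℝ}

theorem norm_patternTerm_le (hM : IsPairedMoment τ M C) (e : Bool) (l : {s // ¬ p s} → ℤ) {n : ℕ}
    (hn : 1 ≤ n) (z : Option (Quotient S) → ℕ) : ‖patternTerm τ M e S σ l n z‖ ≤ C := by
  have h := hM.bound n hn (signedPoint S σ z)
  have h0 : 0 ≤ C := (norm_nonneg _).trans h
  rw [patternTerm]
  split_ifs <;> simp [h0, h]

theorem patternTerm_eq_zero (hM : IsPairedMoment τ M C) (e : Bool) (l : {s // ¬ p s} → ℤ) {n : ℕ}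
    (hn : 1 ≤ n) (z : Option (Quotient S) → ℕ) (s : {s // p s}) (hs : ∀ s', S s' s → s' = s) :
    patternTerm τ M e S σ l n z = 0 := by
  rw [patternTerm]
  by_cases h : IsPattern τ S σ (signedPoint S σ z)
  · rw [if_pos h, hM.zero n hn _ s, zero_mul]
    intro s' hs'
    apply hs
    rw [← h.1]
    exact hs'
  · rw [if_neg h]

open scoped Classical in
-- The value is read off at any one point with this pattern, for any `n₀ ≥ 1`; if there is none, any
-- number serves.
theorem exists_pairedMoment_value (hM : IsPairedMoment τ M C)
    (hns : ∀ s, ∃ s', S s' s ∧ s' ≠ s)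
    (hcard : 2 * Fintype.card (Quotient S) = Fintype.card {s // p s}) :
    ∃ v : ℂ, ∀ n, 1 ≤ n → ∀ z : Option (Quotient S) → ℕ, (∀ q, 0 < z (some q)) →
      IsPattern τ S σ (signedPoint S σ z) → M n (signedPoint S σ z) = v := by
  by_cases hex : ∃ n, 1 ≤ n ∧ ∃ z : Option (Quotient S) → ℕ, (∀ q, 0 < z (some q)) ∧
      IsPattern τ S σ (signedPoint S σ z)
  · obtain ⟨n₀, hn₀, z₀, hz₀, hp₀⟩ := hex
    refine ⟨M n₀ (signedPoint S σ z₀), fun n hn z hz hp => ?_⟩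
    have hne : ∀ z : Option (Quotient S) → ℕ, (∀ q, 0 < z (some q)) →
        ∀ s, signedPoint S σ z s ≠ 0 := by
      intro z hz s h0
      have h₁ := natAbs_signedPoint S σ z s
      have h₂ := hz (Quotient.mk S s)
      rw [h0] at h₁
      simp only [Int.natAbs_zero] at h₁
      omega
    refine hM.congr n n₀ hn hn₀ _ _ (hp.1.trans hp₀.1.symm) (fun s => ?_) (hne z hz)
      (hne z₀ hz₀) fun s => ?_
    · rw [← (two_mul_card_quotient_le hns).2 hcard s]
      congr 1
      ext s'
      simp only [Finset.mem_filter, Finset.mem_univ, true_and]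
      conv_rhs => rw [← hp.1]
      rfl
    · have h₁ := (congrFun hp.2 s).trans (congrFun hp₀.2 s).symm
      simp only [decide_eq_decide] at h₁
      omega
  · exact ⟨0, fun n hn z hz hp => absurd ⟨n, hn, z, hz, hp⟩ hex⟩

open scoped Classical in
-- The start has coefficient `1` in each position and `2` in the last form, since the steps do not
-- involve it. These forms are therefore nonzero, and finitely many null hyperplanes are excluded.
theorem ae_generic (S : Setoid {s // p s}) (σ : {s // p s} → Bool) :
    ∀ᵐ x : Option (Quotient S) → ℝ, (∀ o, x o ≠ 0) ∧
      (∀ q q' : Quotient S, x (some q) = x (some q') → q = q') ∧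
      (∀ s, positionForm p S σ s x ≠ 0 ∧ positionForm p S σ s x ≠ 1) ∧
      (∑ s, stepForm p S σ s ≠ 0 → (∑ s, stepForm p S σ s) x ≠ 0) ∧
      2 * x none - (∑ s, stepForm p S σ s) x ≠ 1 := by
  refine Filter.Eventually.and ?_ (Filter.Eventually.and ?_ (Filter.Eventually.and ?_
    (Filter.Eventually.and ?_ ?_)))
  · rw [ae_all_iff]
    exact fun o => ae_linearMap_ne (LinearMap.proj o) (Pi.single o 1) (by simp) 0
  · rw [ae_all_iff]
    intro q
    rw [ae_all_iff]
    intro q'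
    by_cases hq : q = q'
    · exact Eventually.of_forall fun _ _ => hq
    · let π (q : Quotient S) : (Option (Quotient S) → ℝ) →ₗ[ℝ] ℝ := LinearMap.proj (some q)
      have hL : (π q - π q') (Pi.single (some q) 1) ≠ 0 := by
        rw [LinearMap.sub_apply, LinearMap.proj_apply, LinearMap.proj_apply, Pi.single_eq_same,
          Pi.single_eq_of_ne (by simpa using Ne.symm hq)]
        norm_num
      have := ae_linearMap_ne _ _ hL 0
      filter_upwards [this] with x hx h
      exact absurd (sub_eq_zero.2 h) hx
  · rw [ae_all_iff]
    exact fun s => (ae_linearMap_ne (positionForm p S σ s) (Pi.single none 1)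
      (by simp [positionForm_single_none]) 0).and
      (ae_linearMap_ne (positionForm p S σ s) (Pi.single none 1)
      (by simp [positionForm_single_none]) 1)
  · by_cases h : ∑ s, stepForm p S σ s = 0
    · exact Eventually.of_forall fun _ h' => absurd h h'
    · obtain ⟨v, hv⟩ : ∃ v, (∑ s, stepForm p S σ s) v ≠ 0 := by
        by_contra! hv
        exact h (LinearMap.ext hv)
      filter_upwards [ae_linearMap_ne _ v hv 0] with x hx _ using hx
  · have := ae_linearMap_ne ((2 : ℝ) • LinearMap.proj none - ∑ s, stepForm p S σ s :
      (Option (Quotient S) → ℝ) →ₗ[ℝ] ℝ) (Pi.single none 1)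
      (by simp [LinearMap.sum_apply, stepForm_single_none]) 1
    filter_upwards [this] with x hx
    simpa using hx

open scoped Classical in
/-- The limit of the contributions of the lattice points near `n x` for `∑ l = 0`. -/
noncomputable def limitTerm (τ : {s // p s} → Fin m × Bool × Bool) (e : Bool)
    (S : Setoid {s // p s}) (σ : {s // p s} → Bool) (v : ℂ) (x : Option (Quotient S) → ℝ) : ℂ :=
  if (∀ s s', S s s' → (τ s).1 = (τ s').1) ∧
    (∀ s, 0 < positionForm p S σ s x ∧ positionForm p S σ s x < 1) ∧
    e = false ∧ ∑ s, stepForm p S σ s = 0 then v else 0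

/-- The positions stay off the boundary, so the limits decide whether the path stays inside. Closing
fails for large `n` whenever its form is not identically zero; if it is, closing amounts to `∑ l =
0` exactly. -/
theorem eventually_isClosedPath_iff (e : Bool) (l : {s // ¬ p s} → ℤ)
    {x : Option (Quotient S) → ℝ} (hx : ∀ o, 0 ≤ x o)
    (h₁ : ∀ s, positionForm p S σ s x ≠ 0 ∧ positionForm p S σ s x ≠ 1)
    (h₂ : ∑ s, stepForm p S σ s ≠ 0 → (∑ s, stepForm p S σ s) x ≠ 0)
    (h₃ : 2 * x none - (∑ s, stepForm p S σ s) x ≠ 1) :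
    ∀ᶠ n : ℕ in atTop,
      IsClosedPath n e (glue p (signedPoint S σ fun o => ⌊n * x o⌋₊) l) (⌊n * x none⌋₊ : ℕ) ↔
        (∀ s, 0 < positionForm p S σ s x ∧ positionForm p S σ s x < 1) ∧
        e = false ∧ ∑ s, stepForm p S σ s = 0 ∧ ∑ s, l s = 0 := by
  have hone : Tendsto (fun n : ℕ => (n : ℝ) / n) atTop (𝓝 1) := by
    refine tendsto_const_nhds.congr' ?_
    filter_upwards [eventually_gt_atTop 0] with n hn
    rw [div_self]
    exact_mod_cast hn.ne'
  have hpos : ∀ᶠ n : ℕ in atTop, ∀ s,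
      (0 ≤ ((⌊n * x none⌋₊ : ℕ) : ℤ) -
        partialSum (glue p (signedPoint S σ fun o => ⌊n * x o⌋₊) l) s ∧
      ((⌊n * x none⌋₊ : ℕ) : ℤ) -
        partialSum (glue p (signedPoint S σ fun o => ⌊n * x o⌋₊) l) s < n) ↔
      (0 < positionForm p S σ s x ∧ positionForm p S σ s x < 1) := by
    rw [eventually_all]
    intro s
    have t₁ := tendsto_position p S σ l hx s
    have t₂ := hone.sub t₁
    have t₃ : Tendsto (fun n : ℕ => (((n : ℤ) - ((⌊n * x none⌋₊ : ℕ) -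
        partialSum (glue p (signedPoint S σ fun o => ⌊n * x o⌋₊) l) s) : ℤ) : ℝ) / n) atTop
        (𝓝 (1 - positionForm p S σ s x)) := by
      refine t₂.congr fun n => ?_
      rw [← sub_div]
      push_cast
      rfl
    filter_upwards [eventually_sign t₁ (h₁ s).1 0,
      eventually_sign t₃ (sub_ne_zero.2 (h₁ s).2.symm) 0] with n e₁ e₂
    rw [e₁.1, ← sub_pos (b := (((⌊n * x none⌋₊ : ℕ) : ℤ) - _)), e₂.2.1, sub_pos]
  have hclosed : ∀ᶠ n : ℕ in atTop, (((⌊n * x none⌋₊ : ℕ) : ℤ) -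
      ∑ s, glue p (signedPoint S σ fun o => ⌊n * x o⌋₊) l s =
        if e then (n : ℤ) - 1 - (⌊n * x none⌋₊ : ℕ) else (⌊n * x none⌋₊ : ℕ)) ↔
      (e = false ∧ ∑ s, stepForm p S σ s = 0 ∧ ∑ s, l s = 0) := by
    have t₁ := tendsto_total p S σ l hx
    cases e
    · simp only [Bool.false_eq_true, if_false, true_and]
      by_cases h0 : ∑ s, stepForm p S σ s = 0
      · refine Eventually.of_forall fun n => ?_
        rw [sum_glue, sum_signedPoint_eq_zero p S σ h0]
        simp only [h0, true_and]
        omega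
      · filter_upwards [eventually_sign t₁ (h₂ h0) 0] with n hn
        simp only [h0, false_and, iff_false]
        have := hn.2.2
        omega
    · simp only [if_true, reduceCtorEq, false_and, iff_false]
      have t₂ : Tendsto (fun n : ℕ => ((2 * (⌊n * x none⌋₊ : ℕ) -
          ∑ s, glue p (signedPoint S σ fun o => ⌊n * x o⌋₊) l s - n : ℤ) : ℝ) / n) atTop
          (𝓝 (2 * x none - (∑ s, stepForm p S σ s) x - 1)) := by
        refine ((((tendsto_floor_mul_div (hx none)).const_mul 2).sub t₁).sub hone).congr
          fun n => ?_
        push_cast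
        ring
      -- Ending at the mirror image means `2i - ∑ κ - n = -1`, whence the excluded value `-1`.
      filter_upwards [eventually_sign t₂ (sub_ne_zero.2 h₃) (-1)] with n hn
      have := hn.2.2
      omega
  filter_upwards [hpos, hclosed] with n e₁ e₂
  rw [IsClosedPath, e₂]
  exact and_congr_left fun _ => forall_congr' e₁

open scoped Classical in
-- The value `v` is chosen before `l`, so that the limit depends on `l` through `∑ l` alone.
theorem tendsto_patternTerm (hM : IsPairedMoment τ M C) (e : Bool)
    (hns : ∀ s, ∃ s', S s' s ∧ s' ≠ s)
    (hcard : 2 * Fintype.card (Quotient S) = Fintype.card {s // p s}) :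
    ∃ v : ℂ, ∀ l : {s // ¬ p s} → ℤ, ∀ᵐ x : Option (Quotient S) → ℝ, (∀ o, 0 ≤ x o ∧ x o < 1) →
      Tendsto (fun n : ℕ => patternTerm τ M e S σ l n fun o => ⌊n * x o⌋₊) atTop
        (𝓝 (if ∑ s, l s = 0 then limitTerm τ e S σ v x else 0)) := by
  obtain ⟨v, hv⟩ := exists_pairedMoment_value (σ := σ) hM hns hcard
  refine ⟨v, fun l => ?_⟩
  filter_upwards [ae_generic S σ] with x hx hx01
  obtain ⟨h₀, h₁, h₂, h₃, h₄⟩ := hx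
  have hx0 : ∀ o, 0 ≤ x o := fun o => (hx01 o).1
  have hpos : ∀ᶠ n : ℕ in atTop, ∀ q : Quotient S, 0 < ⌊n * x (some q)⌋₊ := by
    rw [eventually_all]
    intro q
    have := eventually_sign (u := fun n => ((⌊n * x (some q)⌋₊ : ℕ) : ℤ))
      (by simpa using tendsto_floor_mul_div (hx0 (some q))) (h₀ (some q)) 0
    filter_upwards [this] with n hn
    have := hn.2.1.2 (lt_of_le_of_ne (hx0 _) (h₀ _).symm)
    exact_mod_cast this
  have hinj : ∀ᶠ n : ℕ in atTop, ∀ q q' : Quotient S,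
      ⌊n * x (some q)⌋₊ = ⌊n * x (some q')⌋₊ → q = q' := by
    rw [eventually_all]
    intro q
    rw [eventually_all]
    intro q'
    by_cases hq : q = q'
    · exact Eventually.of_forall fun _ _ => hq
    have t : Tendsto (fun n : ℕ =>
        ((((⌊n * x (some q)⌋₊ : ℕ) : ℤ) - (⌊n * x (some q')⌋₊ : ℕ) : ℤ) : ℝ) / n) atTop
        (𝓝 (x (some q) - x (some q'))) := by
      simpa [sub_div] using (tendsto_floor_mul_div (hx0 (some q))).sub
        (tendsto_floor_mul_div (hx0 (some q')))
    have := eventually_sign t (sub_ne_zero.2 fun h => hq (h₁ q q' h)) 0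
    filter_upwards [this] with n hn h
    exact absurd (by rw [h, sub_self]) hn.2.2
  refine tendsto_const_nhds.congr' ?_
  filter_upwards [hpos, hinj, eventually_isClosedPath_iff e l hx0 h₂ h₃ h₄,
    eventually_ge_atTop 1] with n e₁ e₂ e₃ hn
  rw [patternTerm, limitTerm]
  have e₄ := isPattern_signedPoint_iff (τ := τ) (S := S) (σ := σ)
    (z := fun o => ⌊n * x o⌋₊) e₂ e₁
  by_cases hp : IsPattern τ S σ (signedPoint S σ fun o => ⌊n * x o⌋₊)
  · rw [if_pos hp, hv n hn _ e₁ hp]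
    have hc := e₄.1 hp
    by_cases hl : ∑ s, l s = 0
    · simp only [e₃, hl, and_true, if_true, if_congr (and_iff_right hc) rfl rfl, mul_ite, mul_one,
        mul_zero]
    · simp only [e₃, hl, and_false, if_false, mul_zero]
  · rw [if_neg hp]
    simp only [mt e₄.2 hp, false_and, if_false, ite_self]

end Pattern

/-! ### Normalization and summation over patterns -/

section PatternSum

variable {m r : ℕ} {p : Fin r → Prop} [DecidablePred p] {τ : {s // p s} → Fin m × Bool × Bool}
  {M : ℕ → ({s // p s} → ℤ) → ℂ} {C : ℝ}

/-- The normalization splits into the volume factor of a Riemann sum in `q + 1` variables and a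
surplus that is `1` for pairings and tends to zero otherwise. -/
theorem sqrt_inv_pow_eq {n t q : ℕ} (h : 2 * q ≤ t) :
    (n : ℂ)⁻¹ * ((((Real.sqrt n)⁻¹ : ℝ) : ℂ)) ^ t =
      (((((Real.sqrt n)⁻¹ : ℝ) : ℂ)) ^ (t - 2 * q)) * ((n : ℂ) ^ (q + 1))⁻¹ := by
  have hsq : (((Real.sqrt n)⁻¹ : ℝ) : ℂ) ^ 2 = (n : ℂ)⁻¹ := by
    rw [← Complex.ofReal_pow, inv_pow, Real.sq_sqrt (Nat.cast_nonneg n)]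
    simp
  obtain ⟨k, rfl⟩ := Nat.exists_eq_add_of_le h
  rw [Nat.add_sub_cancel_left, pow_add, pow_mul, hsq, ← inv_pow, pow_succ]
  ring

open scoped Classical in
/-- The contribution of the pattern `(S, σ)` to the moment. -/
noncomputable def patternSum (τ : {s // p s} → Fin m × Bool × Bool)
    (M : ℕ → ({s // p s} → ℤ) → ℂ) (e : Bool) (S : Setoid {s // p s}) (σ : {s // p s} → Bool)
    (l : {s // ¬ p s} → ℤ) (n : ℕ) : ℂ :=
  (n : ℂ)⁻¹ * (((Real.sqrt n)⁻¹ : ℝ) : ℂ) ^ Fintype.card {s // p s} *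
    ∑ z ∈ Fintype.piFinset fun _ : Option (Quotient S) => Finset.range n,
      patternTerm τ M e S σ l n z

theorem patternSum_eq_zero (hM : IsPairedMoment τ M C) (e : Bool) {S : Setoid {s // p s}}
    (σ : {s // p s} → Bool) (l : {s // ¬ p s} → ℤ) {n : ℕ} (hn : 1 ≤ n)
    (hs : ¬ ∀ s, ∃ s', S s' s ∧ s' ≠ s) : patternSum τ M e S σ l n = 0 := by
  push Not at hs
  obtain ⟨s, hs⟩ := hs
  rw [patternSum, Finset.sum_eq_zero fun z _ => patternTerm_eq_zero hM e l hn z s hs, mul_zero]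

/-- The bound does not involve `l`; this uniformity is what dominates the later summation over `l`.
-/
theorem norm_patternSum_le (hM : IsPairedMoment τ M C) (e : Bool) (S : Setoid {s // p s})
    (σ : {s // p s} → Bool) (l : {s // ¬ p s} → ℤ) {n : ℕ} (hn : 1 ≤ n) :
    ‖patternSum τ M e S σ l n‖ ≤ C := by
  classical
  have h0 : 0 ≤ C := (norm_nonneg _).trans (hM.bound n hn 0)
  by_cases hns : ∀ s, ∃ s', S s' s ∧ s' ≠ s
  · have hn' : (1 : ℝ) ≤ n := by exact_mod_cast hn
    rw [patternSum, sqrt_inv_pow_eq (two_mul_card_quotient_le hns).1, norm_mul, norm_mul]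
    have h₁ : ‖(((Real.sqrt n)⁻¹ : ℝ) : ℂ) ^
        (Fintype.card {s // p s} - 2 * Fintype.card (Quotient S))‖ ≤ 1 := by
      rw [norm_pow, Complex.norm_real, Real.norm_of_nonneg (by positivity)]
      exact pow_le_one₀ (by positivity) (inv_le_one_of_one_le₀ (Real.one_le_sqrt.2 hn'))
    have h₂ : ‖∑ z ∈ Fintype.piFinset fun _ : Option (Quotient S) => Finset.range n,
        patternTerm τ M e S σ l n z‖ ≤ (n : ℝ) ^ (Fintype.card (Quotient S) + 1) * C := by
      refine (norm_sum_le_of_le _ fun z _ => norm_patternTerm_le hM e l hn z).trans ?_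
      rw [Finset.sum_const, nsmul_eq_mul, Fintype.card_piFinset, Finset.prod_const,
        Finset.card_univ, Fintype.card_option, Finset.card_range, Nat.cast_pow]
    have h₃ : ‖((n : ℂ) ^ (Fintype.card (Quotient S) + 1))⁻¹‖ =
        ((n : ℝ) ^ (Fintype.card (Quotient S) + 1))⁻¹ := by
      rw [norm_inv, norm_pow, Complex.norm_natCast]
    rw [h₃]
    calc _ ≤ 1 * ((n : ℝ) ^ (Fintype.card (Quotient S) + 1))⁻¹ *
        ((n : ℝ) ^ (Fintype.card (Quotient S) + 1) * C) := by gcongr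
      _ = C := by
        rw [one_mul, inv_mul_cancel_left₀]
        positivity
  · rw [patternSum_eq_zero hM e σ l hn hns, norm_zero]
    exact h0

theorem tendsto_patternSum (hM : IsPairedMoment τ M C) (e : Bool) (S : Setoid {s // p s})
    (σ : {s // p s} → Bool) :
    ∃ G : ℂ, (Odd (Fintype.card {s // p s}) → G = 0) ∧ (e = true → G = 0) ∧
      ∀ l : {s // ¬ p s} → ℤ, Tendsto (fun n => patternSum τ M e S σ l n) atTop
        (𝓝 (if ∑ s, l s = 0 then G else 0)) := by
  classical
  by_cases hns : ∀ s, ∃ s', S s' s ∧ s' ≠ s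
  · obtain ⟨hle, -⟩ := two_mul_card_quotient_le hns
    have hrw : ∀ l, (fun n => patternSum τ M e S σ l n) = fun n : ℕ =>
        (((Real.sqrt n)⁻¹ : ℝ) : ℂ) ^
          (Fintype.card {s // p s} - 2 * Fintype.card (Quotient S)) *
        (((n : ℂ) ^ Fintype.card (Option (Quotient S)))⁻¹ *
          ∑ z ∈ Fintype.piFinset fun _ : Option (Quotient S) => Finset.range n,
            patternTerm τ M e S σ l n z) := by
      intro l
      ext n
      rw [patternSum, sqrt_inv_pow_eq hle, Fintype.card_option, mul_assoc]
    rcases hle.eq_or_lt with heq | hlt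
    · obtain ⟨v, hv⟩ := tendsto_patternTerm (σ := σ) hM e hns heq
      refine ⟨∫ x in Set.univ.pi fun _ : Option (Quotient S) => Set.Ico (0 : ℝ) 1,
        limitTerm τ e S σ v x, fun hodd => ?_, fun he => ?_, fun l => ?_⟩
      · rw [← heq] at hodd
        exact absurd hodd (by simp)
      · simp [limitTerm, he]
      · rw [hrw, heq, Nat.sub_self]
        simp only [pow_zero, one_mul]
        convert tendsto_riemannSum (fun n z => patternTerm τ M e S σ l n z) C
          (fun n hn z => norm_patternTerm_le hM e l hn z) _ (hv l) using 2
        split_ifs <;> simp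
    -- Some class has more than two elements: the Riemann sum stays bounded, and the surplus power
    -- of `n^(-1/2)` sends the product to zero.
    · refine ⟨0, fun _ => rfl, fun _ => rfl, fun l => ?_⟩
      simp only [ite_self]
      have hz : Tendsto (fun n : ℕ => (((Real.sqrt n)⁻¹ : ℝ) : ℂ) ^
          (Fintype.card {s // p s} - 2 * Fintype.card (Quotient S))) atTop (𝓝 0) := by
        have h₁ : Tendsto (fun n : ℕ => (Real.sqrt n)⁻¹) atTop (𝓝 0) :=
          tendsto_inv_atTop_zero.comp (Real.tendsto_sqrt_atTop.comp tendsto_natCast_atTop_atTop)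
        have h₂ := ((Complex.continuous_ofReal.tendsto 0).comp h₁).pow
          (Fintype.card {s // p s} - 2 * Fintype.card (Quotient S))
        rw [Complex.ofReal_zero, zero_pow (by omega)] at h₂
        exact h₂
      rw [hrw]
      refine hz.zero_mul_isBoundedUnder_le ?_
      refine isBoundedUnder_of_eventually_le (a := C) ?_
      filter_upwards [eventually_ge_atTop 1] with n hn
      simp only [Function.comp, norm_mul, norm_inv, norm_pow, Complex.norm_natCast]
      have hn' : (0 : ℝ) < n := by exact_mod_cast hn
      rw [inv_mul_le_iff₀ (by positivity)]
      refine (norm_sum_le_of_le _ fun z _ => norm_patternTerm_le hM e l hn z).trans ?_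
      rw [Finset.sum_const, nsmul_eq_mul, Fintype.card_piFinset, Finset.prod_const,
        Finset.card_univ, Finset.card_range, Nat.cast_pow]
  · refine ⟨0, fun _ => rfl, fun _ => rfl, fun l => ?_⟩
    simp only [ite_self]
    refine tendsto_const_nhds.congr' ?_
    filter_upwards [eventually_ge_atTop 1] with n hn
    exact (patternSum_eq_zero hM e σ l hn hns).symm

open scoped Classical in
/-- The moment with the indices `l` of the deterministic letters fixed. -/
noncomputable def pathSum (M : ℕ → ({s // p s} → ℤ) → ℂ) (e : Bool) (l : {s // ¬ p s} → ℤ)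
    (n : ℕ) : ℂ :=
  (n : ℂ)⁻¹ * (((Real.sqrt n)⁻¹ : ℝ) : ℂ) ^ Fintype.card {s // p s} *
    ∑ k ∈ Fintype.piFinset fun _ : {s // p s} => Finset.Ioo (-n : ℤ) n, M n k *
      ∑ i ∈ Finset.range n, if IsClosedPath n e (glue p k l) i then 1 else 0

theorem pathSum_eq (τ : {s // p s} → Fin m × Bool × Bool) (M : ℕ → ({s // p s} → ℤ) → ℂ)
    (e : Bool) (l : {s // ¬ p s} → ℤ) (n : ℕ) :
    pathSum M e l n = ∑ S, ∑ σ, patternSum τ M e S σ l n := by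
  classical
  simp only [pathSum, patternSum, patternTerm, ← Finset.mul_sum]
  simp only [Finset.mul_sum (Finset.range n)]
  rw [sum_eq_sum_patterns τ]

theorem norm_pathSum_le (hM : IsPairedMoment τ M C) (e : Bool) (l : {s // ¬ p s} → ℤ) {n : ℕ}
    (hn : 1 ≤ n) :
    ‖pathSum M e l n‖ ≤ ∑ _S : Setoid {s // p s}, ∑ _σ : {s // p s} → Bool, C := by
  rw [pathSum_eq τ]
  exact norm_sum_le_of_le _ fun S _ => norm_sum_le_of_le _ fun σ _ =>
    norm_patternSum_le hM e S σ l hn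

theorem tendsto_pathSum (hM : IsPairedMoment τ M C) (e : Bool) :
    ∃ G : ℂ, (Odd (Fintype.card {s // p s}) → G = 0) ∧ (e = true → G = 0) ∧
      ∀ l : {s // ¬ p s} → ℤ, Tendsto (fun n => pathSum M e l n) atTop
        (𝓝 (if ∑ s, l s = 0 then G else 0)) := by
  choose G h₁ h₂ h₃ using tendsto_patternSum hM e
  refine ⟨∑ S, ∑ σ, G S σ, fun h => ?_, fun h => ?_, fun l => ?_⟩
  · simp only [fun S σ => h₁ S σ h, Finset.sum_const_zero]
  · simp only [fun S σ => h₂ S σ h, Finset.sum_const_zero]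
  · simp only [pathSum_eq τ]
    have : Tendsto (fun n => ∑ S, ∑ σ, patternSum τ M e S σ l n) atTop
        (𝓝 (∑ S, ∑ σ, if ∑ s, l s = 0 then G S σ else 0)) :=
      tendsto_finsetSum _ fun S _ => tendsto_finsetSum _ fun σ _ => h₃ S σ l
    convert this using 2
    split_ifs <;> simp

end PatternSum

/-! ### Summation over the deterministic letters -/

/-- A finite set of families lies in a box, over which the sum of products factors. -/
theorem summable_prod_pi {D K : Type*} [Fintype D] {f : D → K → ℝ} (h0 : ∀ s k, 0 ≤ f s k)
    (hf : ∀ s, Summable (f s)) : Summable fun l : D → K => ∏ s, f s (l s) := by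
  classical
  refine summable_of_sum_le (c := ∏ s, ∑' k, f s k)
    (fun l => Finset.prod_nonneg fun s _ => h0 s _) fun u => ?_
  calc ∑ l ∈ u, ∏ s, f s (l s) ≤
      ∑ l ∈ Fintype.piFinset fun s => u.image fun l => l s, ∏ s, f s (l s) := by
        refine Finset.sum_le_sum_of_subset_of_nonneg (fun l hl => ?_)
          fun l _ _ => Finset.prod_nonneg fun s _ => h0 s _
        exact Fintype.mem_piFinset.2 fun s => Finset.mem_image_of_mem _ hl
    _ = ∏ s, ∑ k ∈ u.image fun l => l s, f s k := (Finset.prod_univ_sum _ _).symm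
    _ ≤ _ := Finset.prod_le_prod (fun s _ => Finset.sum_nonneg fun k _ => h0 s k)
        fun s _ => (hf s).sum_le_tsum _ fun k _ => h0 s k

/-- The constant term of the product of the Laurent series with coefficients `d s`. -/
noncomputable def constantTerm {r : ℕ} (d : Fin r → ℤ → ℂ) : ℂ :=
  ∑' l : Fin r → ℤ, if ∑ s, l s = 0 then ∏ s, d s (l s) else 0

/-- Identity factors allow only index zero, so they may be dropped from the constant term. -/
theorem constantTerm_eq {r : ℕ} (p : Fin r → Prop) [DecidablePred p] {d : Fin r → ℤ → ℂ}
    (hd : ∀ s, p s → d s = Pi.single 0 1) :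
    constantTerm d = ∑' l : {s // ¬ p s} → ℤ,
      if ∑ s, l s = 0 then ∏ s : {s // ¬ p s}, d s (l s) else 0 := by
  have hinj : Function.Injective fun l : {s // ¬ p s} → ℤ => glue p (fun _ => 0) l := by
    intro l l' h
    ext s
    have := congrFun h s
    simpa [glue, s.2] using this
  rw [constantTerm, ← hinj.tsum_eq]
  · refine tsum_congr fun l => ?_
    rw [sum_glue, Finset.sum_const_zero, zero_add]
    refine if_congr Iff.rfl ?_ rfl
    rw [← Fintype.prod_subtype_mul_prod_subtype p]
    rw [Finset.prod_eq_one, one_mul]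
    · exact Finset.prod_congr rfl fun s _ => by simp [glue, s.2]
    · intro s _
      simp [glue, s.2, hd s s.2]
  · intro l hl
    refine ⟨fun s => l s, ?_⟩
    ext s
    by_cases hs : p s
    · simp only [glue, hs, dif_pos]
      by_contra hne
      apply hl
      have : ∏ s, d s (l s) = 0 := by
        refine Finset.prod_eq_zero (Finset.mem_univ s) ?_
        rw [hd s hs, Pi.single_eq_of_ne (Ne.symm hne)]
      simp [this]
    · simp [glue, hs]

/-- `G` is chosen before `d`: changing the deterministic letters, in particular replacing them by
identities, leaves the random factor unchanged. The limit passes through the sum because the `d s`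
are absolutely summable. -/
theorem tendsto_sum_pathSum {m r : ℕ} {p : Fin r → Prop} [DecidablePred p]
    {τ : {s // p s} → Fin m × Bool × Bool} {M : ℕ → ({s // p s} → ℤ) → ℂ} {C : ℝ}
    (hM : IsPairedMoment τ M C) (e : Bool) :
    ∃ G : ℂ, (Odd (Fintype.card {s // p s}) → G = 0) ∧ (e = true → G = 0) ∧
      ∀ d : Fin r → ℤ → ℂ, (∀ s, Summable fun k => ‖d s k‖) →
        (∀ s, p s → d s = Pi.single 0 1) →
        Tendsto (fun n : ℕ => ∑ l ∈ Fintype.piFinset fun _ : {s // ¬ p s} => Finset.Ioo (-n : ℤ) n,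
          (∏ s : {s // ¬ p s}, d s (l s)) * pathSum M e l n) atTop (𝓝 (constantTerm d * G)) := by
  obtain ⟨G, h₁, h₂, h₃⟩ := tendsto_pathSum hM e
  refine ⟨G, h₁, h₂, fun d hd hp => ?_⟩
  have hlim : constantTerm d * G = ∑' l : {s // ¬ p s} → ℤ,
      (∏ s : {s // ¬ p s}, d s (l s)) * (if ∑ s, l s = 0 then G else 0) := by
    rw [constantTerm_eq p hp, ← tsum_mul_right]
    refine tsum_congr fun l => ?_
    split_ifs <;> simp
  have hsum : ∀ n : ℕ, ∑ l ∈ Fintype.piFinset fun _ : {s // ¬ p s} => Finset.Ioo (-n : ℤ) n,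
      (∏ s : {s // ¬ p s}, d s (l s)) * pathSum M e l n = ∑' l : {s // ¬ p s} → ℤ,
        if l ∈ Fintype.piFinset fun _ : {s // ¬ p s} => Finset.Ioo (-n : ℤ) n then
          (∏ s : {s // ¬ p s}, d s (l s)) * pathSum M e l n else 0 := by
    intro n
    rw [tsum_eq_sum fun l hl => if_neg hl]
    exact Finset.sum_congr rfl fun l hl => (if_pos hl).symm
  simp only [hsum, hlim]
  set C' : ℝ := ∑ _S : Setoid {s // p s}, ∑ _σ : {s // p s} → Bool, C with hC'
  have h0 : 0 ≤ C' := (norm_nonneg _).trans (norm_pathSum_le hM e 0 le_rfl)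
  refine tendsto_tsum_of_dominated_convergence
    (bound := fun l => (∏ s : {s // ¬ p s}, ‖d s (l s)‖) * C') ?_ (fun l => ?_) ?_
  · exact (summable_prod_pi (f := fun (s : {s // ¬ p s}) k => ‖d s k‖)
      (fun s k => norm_nonneg _) fun s => hd s).mul_right _
  · refine ((h₃ l).const_mul _).congr' ?_
    have : ∀ᶠ n : ℕ in atTop, ∀ s, l s ∈ Finset.Ioo (-n : ℤ) n := by
      rw [eventually_all]
      intro s
      filter_upwards [eventually_gt_atTop (l s).natAbs] with n hn
      rw [Finset.mem_Ioo]
      omega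
    filter_upwards [this] with n hn
    rw [if_pos (Fintype.mem_piFinset.2 hn)]
  · filter_upwards [eventually_ge_atTop 1] with n hn l
    split_ifs
    · rw [norm_mul, norm_prod]
      gcongr
      exact norm_pathSum_le hM e l hn
    · rw [norm_zero]
      positivity

theorem sum_piFinset_glue {r : ℕ} (p : Fin r → Prop) [DecidablePred p] (A : Finset ℤ)
    (F : (Fin r → ℤ) → ℂ) :
    ∑ κ ∈ Fintype.piFinset fun _ : Fin r => A, F κ =
      ∑ l ∈ Fintype.piFinset fun _ : {s // ¬ p s} => A,
        ∑ k ∈ Fintype.piFinset fun _ : {s // p s} => A, F (glue p k l) := by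
  rw [← Finset.sum_product']
  have hglue : ∀ κ : Fin r → ℤ, glue p (fun s => κ s) (fun s => κ s) = κ := by
    intro κ
    ext s
    simp [glue]
  refine Finset.sum_bij' (fun κ _ => (fun s => κ s, fun s => κ s)) (fun x _ => glue p x.2 x.1)
    ?_ ?_ ?_ ?_ ?_
  · intro κ hκ
    simp only [Finset.mem_product, Fintype.mem_piFinset] at hκ ⊢
    exact ⟨fun s => hκ s, fun s => hκ s⟩
  · intro x hx
    simp only [Finset.mem_product, Fintype.mem_piFinset] at hx ⊢
    intro s
    rw [glue]
    split_ifs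
    · exact hx.2 _
    · exact hx.1 _
  · intro κ _
    exact hglue κ
  · rintro ⟨l, k⟩ _
    refine Prod.ext (funext fun s => ?_) (funext fun s => ?_)
    · simp [glue, s.2]
    · simp [glue, s.2]
  · intro κ _
    rw [hglue]

theorem matrixState_prod_toeplitz {m r n : ℕ} {Ω : Type*} [MeasurableSpace Ω] {μ : Measure Ω}
    [IsProbabilityMeasure μ] {σx σy ρ₁ ρ₂ ρ₃ ρ₄ ρ₅ ρ₆ : ℝ} {c : ℕ → ℝ} {a : Fin m → ℤ → Ω → ℂ}
    (h : ∀ i, PairCorrelated μ σx σy ρ₁ ρ₂ ρ₃ ρ₄ ρ₅ ρ₆ c (a i))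
    (p : Fin r → Prop) [DecidablePred p] (τ : {s // p s} → Fin m × Bool × Bool) (e : Bool)
    (d : Fin r → ℤ → ℂ) (B : Ω → Fin r → ℤ → ℂ)
    (hT : ∀ ω (s : {s // p s}), B ω s =
      fun k => (((Real.sqrt n)⁻¹ : ℝ) : ℂ) * inputEntry a (τ s) k ω)
    (hD : ∀ ω s, ¬ p s → B ω s = d s) (M : ℕ → ({s // p s} → ℤ) → ℂ)
    (hM : M n = mixedMoment μ a τ) :
    Integrable (fun ω =>
        ((List.ofFn fun s => toeplitz n (B ω s)).prod * flipMatrix n e).trace) μ ∧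
      matrixState μ (fun ω => (List.ofFn fun s => toeplitz n (B ω s)).prod * flipMatrix n e) =
        ∑ l ∈ Fintype.piFinset fun _ : {s // ¬ p s} => Finset.Ioo (-n : ℤ) n,
          (∏ s : {s // ¬ p s}, d s (l s)) * pathSum M e l n := by
  classical
  have htrace : ∀ ω, ((List.ofFn fun s => toeplitz n (B ω s)).prod * flipMatrix n e).trace =
      ∑ l ∈ Fintype.piFinset fun _ : {s // ¬ p s} => Finset.Ioo (-n : ℤ) n,
        ∑ k ∈ Fintype.piFinset fun _ : {s // p s} => Finset.Ioo (-n : ℤ) n,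
          ((∏ s : {s // ¬ p s}, d s (l s)) *
            (((Real.sqrt n)⁻¹ : ℝ) : ℂ) ^ Fintype.card {s // p s} *
            ∑ i ∈ Finset.range n, if IsClosedPath n e (glue p k l) i then 1 else 0) *
          ∏ s, inputEntry a (τ s) (k s) ω := by
    intro ω
    rw [trace_prod_toeplitz, sum_piFinset_glue p]
    refine Finset.sum_congr rfl fun l _ => Finset.sum_congr rfl fun k _ => ?_
    rw [← Fintype.prod_subtype_mul_prod_subtype p]
    have e₁ : ∏ s : {s // p s}, B ω s (glue p k l s) =
        (((Real.sqrt n)⁻¹ : ℝ) : ℂ) ^ Fintype.card {s // p s} *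
          ∏ s, inputEntry a (τ s) (k s) ω := by
      rw [← Finset.card_univ, ← Finset.prod_const, ← Finset.prod_mul_distrib]
      refine Finset.prod_congr rfl fun s _ => ?_
      rw [hT]
      simp [glue, s.2]
    have e₂ : ∏ s : {s // ¬ p s}, B ω s (glue p k l s) = ∏ s : {s // ¬ p s}, d s (l s) := by
      refine Finset.prod_congr rfl fun s _ => ?_
      rw [hD ω s s.2]
      simp [glue, s.2]
    rw [e₁, e₂]
    ring
  have hint : ∀ (z : ℂ) (k : {s // p s} → ℤ),
      Integrable (fun ω => z * ∏ s, inputEntry a (τ s) (k s) ω) μ := fun z k =>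
    (integrable_prod_inputEntry h τ k).const_mul z
  simp only [matrixState, htrace]
  refine ⟨integrable_finsetSum _ fun l _ => integrable_finsetSum _ fun k _ => hint _ k, ?_⟩
  rw [integral_finsetSum _ fun l _ => integrable_finsetSum _ fun k _ => hint _ k, Finset.mul_sum]
  refine Finset.sum_congr rfl fun l _ => ?_
  rw [integral_finsetSum _ fun k _ => hint _ k, pathSum, hM, Finset.mul_sum, Finset.mul_sum,
    Finset.mul_sum]
  refine Finset.sum_congr rfl fun k _ => ?_
  rw [integral_const_mul, mixedMoment]
  ring

theorem isPairedMoment_mixedMoment {m r : ℕ} {Ω : ℕ → Type*} [∀ n, MeasurableSpace (Ω n)]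
    {μ : ∀ n, Measure (Ω n)} [∀ n, IsProbabilityMeasure (μ n)]
    {σx σy ρ₁ ρ₂ ρ₃ ρ₄ ρ₅ ρ₆ : ℝ} {c : ℕ → ℝ} {a : ∀ n, Fin m → ℤ → Ω n → ℂ}
    (h : ∀ n, 1 ≤ n → ∀ i, PairCorrelated (μ n) σx σy ρ₁ ρ₂ ρ₃ ρ₄ ρ₅ ρ₆ c (a n i))
    (hind : ∀ n, 1 ≤ n → iIndepFun (fun i ω j => a n i j ω) (μ n))
    {p : Fin r → Prop} [DecidablePred p] (τ : {s // p s} → Fin m × Bool × Bool) :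
    ∃ C, IsPairedMoment τ (fun n => mixedMoment (μ n) (a n) τ) C :=
  ⟨_, { bound := fun n hn k => norm_mixedMoment_le (h n hn) τ k
        zero := fun n hn k s hs => mixedMoment_eq_zero (h n hn) (hind n hn) τ k s hs
        congr := fun n n' hn hn' k k' h₁ h₂ h₃ h₄ h₅ =>
          mixedMoment_congr (h n hn) (hind n hn) (h n' hn') (hind n' hn') τ k k' h₁ h₂ h₃ h₄ h₅ }⟩

/-- The limit of the moments of a word in Toeplitz matrices splits into a factor that depends on the
deterministic letters only and a factor that depends on the random letters only. -/
theorem tendsto_matrixState_prod_toeplitz {m r : ℕ} {Ω : ℕ → Type*} [∀ n, MeasurableSpace (Ω n)]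
    {μ : ∀ n, Measure (Ω n)} [∀ n, IsProbabilityMeasure (μ n)]
    {σx σy ρ₁ ρ₂ ρ₃ ρ₄ ρ₅ ρ₆ : ℝ} {c : ℕ → ℝ} {a : ∀ n, Fin m → ℤ → Ω n → ℂ}
    (h : ∀ n, 1 ≤ n → ∀ i, PairCorrelated (μ n) σx σy ρ₁ ρ₂ ρ₃ ρ₄ ρ₅ ρ₆ c (a n i))
    (hind : ∀ n, 1 ≤ n → iIndepFun (fun i ω j => a n i j ω) (μ n))
    (p : Fin r → Prop) [DecidablePred p] (τ : {s // p s} → Fin m × Bool × Bool) (e : Bool) :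
    ∃ G : ℂ, (Odd (Fintype.card {s // p s}) → G = 0) ∧ (e = true → G = 0) ∧
      ∀ (d : Fin r → ℤ → ℂ) (B : ∀ n, Ω n → Fin r → ℤ → ℂ), (∀ s, Summable fun k => ‖d s k‖) →
        (∀ s, p s → d s = Pi.single 0 1) →
        (∀ n ω (s : {s // p s}), B n ω s =
          fun k => (((Real.sqrt n)⁻¹ : ℝ) : ℂ) * inputEntry (a n) (τ s) k ω) →
        (∀ n ω s, ¬ p s → B n ω s = d s) →
        (∀ n, 1 ≤ n → Integrable (fun ω =>
          ((List.ofFn fun s => toeplitz n (B n ω s)).prod * flipMatrix n e).trace) (μ n)) ∧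
        Tendsto (fun n => matrixState (μ n) fun ω =>
          (List.ofFn fun s => toeplitz n (B n ω s)).prod * flipMatrix n e) atTop
          (𝓝 (constantTerm d * G)) := by
  obtain ⟨C, hM⟩ := isPairedMoment_mixedMoment h hind τ
  obtain ⟨G, h₁, h₂, h₃⟩ := tendsto_sum_pathSum hM e
  refine ⟨G, h₁, h₂, fun d B hd hdp hT hD => ⟨fun n hn => ?_, ?_⟩⟩
  · exact (matrixState_prod_toeplitz (h n hn) p τ e d (B n) (hT n) (hD n)
      (fun n => mixedMoment (μ n) (a n) τ) rfl).1
  · refine (h₃ d hd hdp).congr' ?_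
    filter_upwards [eventually_ge_atTop 1] with n hn
    exact (matrixState_prod_toeplitz (h n hn) p τ e d (B n) (hT n) (hD n)
      (fun n => mixedMoment (μ n) (a n) τ) rfl).2.symm

/-! ### The limit of the moments of a word -/

theorem sum_get_eq_countP {α : Type*} (u : List α) (f : α → Bool) :
    (∑ s : Fin u.length, if f (u.get s) then 1 else 0) = u.countP f := by
  induction u with
  | nil => rfl
  | cons x u ih =>
    rw [List.countP_cons, ← ih]
    simp only [List.length_cons, Fin.sum_univ_succ, List.get_cons_zero]
    exact add_comm _ _

theorem ofFn_get_eq_map {α β : Type*} (u : List α) (f : α → β) :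
    (List.ofFn fun s : Fin u.length => f (u.get s)) = u.map f := by
  apply List.ext_get <;> simp

theorem constantTerm_single (r : ℕ) :
    constantTerm (fun _ : Fin r => (Pi.single 0 1 : ℤ → ℂ)) = 1 := by
  rw [constantTerm, tsum_eq_single 0]
  · simp
  · intro l hl
    obtain ⟨s, hs⟩ := Function.ne_iff.1 hl
    rw [Finset.prod_eq_zero (Finset.mem_univ s) (Pi.single_eq_of_ne hs _), ite_self]

/-- The number of a letter `T i`. -/
def Letter.indexT {m : ℕ} : (x : Letter m) → x.isT = true → Fin m
  | .T i, _ => i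

/-- The deterministic input sequence of an annotated letter; letters other than the kept `D i` are
represented by the identity. -/
noncomputable def detSeq {m : ℕ} (d : Fin m → ℤ → ℂ) (keep : Letter m → Bool) :
    Letter m × Bool × Bool → ℤ → ℂ
  | (.P, _, _) => Pi.single 0 1
  | (.T _, _, _) => Pi.single 0 1
  | (.D i, s, b) => if keep (.D i) then
      fun k => conjIf s (d i (negIf (xor s b) k)) else Pi.single 0 1

theorem summable_detSeq {m : ℕ} {d : Fin m → ℤ → ℂ} (hd : ∀ i, Summable fun k => ‖d i k‖)
    (keep : Letter m → Bool) (u : Letter m × Bool × Bool) :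
    Summable fun k => ‖detSeq d keep u k‖ := by
  have h1 : Summable fun k => ‖(Pi.single 0 1 : ℤ → ℂ) k‖ :=
    summable_of_ne_finset_zero (s := {0}) fun k hk => by
      rw [Pi.single_eq_of_ne (by simpa using hk), norm_zero]
  obtain ⟨x, s, b⟩ := u
  cases x with
  | P => exact h1
  | T i => exact h1
  | D i =>
    rw [detSeq]
    split_ifs
    · simp only [norm_conjIf]
      cases xor s b
      · simpa [negIf] using hd i
      · simpa [negIf, Function.comp_def] using (Equiv.neg ℤ).summable_iff.2 (hd i)
    · exact h1

theorem letterSeq_of_isT {m : ℕ} {Ω : Type*} (n : ℕ) (a : Fin m → ℤ → Ω → ℂ) (d : Fin m → ℤ → ℂ)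
    (keep : Letter m → Bool) (hk : ∀ i, keep (.T i) = true) (ω : Ω) (u : Letter m × Bool × Bool)
    (hu : u.1.isT = true) :
    letterSeq n a d keep ω u = fun k => (((Real.sqrt n)⁻¹ : ℝ) : ℂ) *
      inputEntry a (u.1.indexT hu, xor u.2.1 u.2.2, u.2.1) k ω := by
  obtain ⟨x, s, b⟩ := u
  cases x with
  | P => simp [Letter.isT] at hu
  | T i => simp [letterSeq, hk, Letter.indexT]
  | D i => simp [Letter.isT] at hu

theorem letterSeq_of_not_isT {m : ℕ} {Ω : Type*} (n : ℕ) (a : Fin m → ℤ → Ω → ℂ)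
    (d : Fin m → ℤ → ℂ) (keep : Letter m → Bool) {kT : Bool} (hk : ∀ i, keep (.T i) = kT) (ω : Ω)
    (u : Letter m × Bool × Bool) (hu : ¬ (u.1.isT && kT) = true) :
    letterSeq n a d keep ω u = detSeq d keep u := by
  obtain ⟨x, s, b⟩ := u
  cases x with
  | P => rfl
  | T i =>
    have : kT = false := by simpa [Letter.isT] using hu
    simp [letterSeq, detSeq, hk, this]
  | D i => rfl

theorem detSeq_of_isT {m : ℕ} (d : Fin m → ℤ → ℂ) (keep : Letter m → Bool)
    (u : Letter m × Bool × Bool) (hu : u.1.isT = true) : detSeq d keep u = Pi.single 0 1 := by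
  obtain ⟨x, s, b⟩ := u
  cases x with
  | P => rfl
  | T i => rfl
  | D i => simp [Letter.isT] at hu

section Words

variable {m : ℕ} {Ω : ℕ → Type*} [∀ n, MeasurableSpace (Ω n)]
  {μ : ∀ n, Measure (Ω n)} [∀ n, IsProbabilityMeasure (μ n)]
  {σx σy ρ₁ ρ₂ ρ₃ ρ₄ ρ₅ ρ₆ : ℝ} {c : ℕ → ℝ} {a : ∀ n, Fin m → ℤ → Ω n → ℂ}

/-- Convergence of the moments of all words obtained from `w` by deleting letters `D i`, and all
letters `T i` if `kT` does not hold. -/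
theorem tendsto_filtered_word
    (h : ∀ n, 1 ≤ n → ∀ i, PairCorrelated (μ n) σx σy ρ₁ ρ₂ ρ₃ ρ₄ ρ₅ ρ₆ c (a n i))
    (hind : ∀ n, 1 ≤ n → iIndepFun (fun i ω j => a n i j ω) (μ n))
    {d : Fin m → ℤ → ℂ} (hd : ∀ i, Summable fun k => ‖d i k‖)
    (w : List (Letter m × Bool)) (kT : Bool) :
    ∃ G : ℂ, (kT = true → Odd (w.countP fun p => p.1.isT) → G = 0) ∧
      (Odd (w.countP fun p => p.1.isP) → G = 0) ∧
      ∀ keep : Letter m → Bool, keep .P = true → (∀ i, keep (.T i) = kT) →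
        (∀ n, 1 ≤ n → Integrable (fun ω => (starMonomial (fun i => modelMatrix n (a n) d i ω)
          (w.filter fun p => keep p.1)).trace) (μ n)) ∧
        Tendsto (fun n => matrixState (μ n) fun ω =>
          starMonomial (fun i => modelMatrix n (a n) d i ω) (w.filter fun p => keep p.1)) atTop
          (𝓝 (constantTerm
            (fun s : Fin (annotate false w).length => detSeq d keep ((annotate false w).get s)) *
              G)) := by
  set u := annotate false w with hu
  obtain ⟨G, h₁, h₂, h₃⟩ := tendsto_matrixState_prod_toeplitz h hind
    -- If the `T` letters are deleted, they are treated as deterministic identities and no random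
    -- letter remains.
    (fun s : Fin u.length => ((u.get s).1.isT && kT) = true)
    (fun s => ((u.get s).1.indexT (Bool.and_elim_left s.2), xor (u.get s).2.1 (u.get s).2.2,
      (u.get s).2.1)) (finalFlip false w)
  refine ⟨G, fun hk hodd => h₁ ?_, fun hodd => h₂ ?_, fun keep hP hT => ?_⟩
  · rw [Fintype.card_subtype, Finset.card_filter]
    simp only [hk, Bool.and_true]
    rw [sum_get_eq_countP u fun x => x.1.isT, hu, countP_annotate]
    exact hodd
  · rw [finalFlip_eq]
    simpa using hodd
  · have hmono : ∀ n (ω : Ω n), starMonomial (fun i => modelMatrix n (a n) d i ω)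
        (w.filter fun p => keep p.1) =
        (List.ofFn fun s => toeplitz n (letterSeq n (a n) d keep ω (u.get s))).prod *
          flipMatrix n (finalFlip false w) := by
      intro n ω
      have := flipMatrix_mul_starMonomial n (a n) d keep hP ω false w
      rw [ofFn_get_eq_map u fun x => toeplitz n (letterSeq n (a n) d keep ω x), hu, ← this]
      simp [flipMatrix]
    simp only [hmono]
    refine h₃ (fun s => detSeq d keep (u.get s))
      (fun n ω s => letterSeq n (a n) d keep ω (u.get s)) (fun s => summable_detSeq hd keep _)
      (fun s hs => detSeq_of_isT d keep _ (Bool.and_elim_left hs)) (fun n ω s => ?_)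
      (fun n ω s hs => letterSeq_of_not_isT n (a n) d keep hT ω _ hs)
    have hkT : kT = true := Bool.and_elim_right s.2
    exact letterSeq_of_isT n (a n) d keep (fun i => (hT i).trans hkT) ω _ _

/-- The words `w` and `w` without `D` share `G`, while `w` and `w` without `T` share the constant
term. As the constant term of identities is `1`, the factorization reduces to showing that the
random factor `G'` of a word without `T` equals `1`, or that `G` vanishes. -/
theorem exists_momentLimit
    (h : ∀ n, 1 ≤ n → ∀ i, PairCorrelated (μ n) σx σy ρ₁ ρ₂ ρ₃ ρ₄ ρ₅ ρ₆ c (a n i))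
    (hind : ∀ n, 1 ≤ n → iIndepFun (fun i ω j => a n i j ω) (μ n))
    {d : Fin m → ℤ → ℂ} (hd : ∀ i, Summable fun k => ‖d i k‖) :
    ∃ L : List (Letter m × Bool) → ℂ,
      (∀ w, (∀ n, 1 ≤ n → Integrable
          (fun ω => (starMonomial (fun i => modelMatrix n (a n) d i ω) w).trace) (μ n)) ∧
        Tendsto (fun n => matrixState (μ n) fun ω =>
          starMonomial (fun i => modelMatrix n (a n) d i ω) w) atTop (𝓝 (L w))) ∧
      (∀ w, L w = L (w.filter fun p => !p.1.isT) * L (w.filter fun p => !p.1.isD)) ∧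
      (∀ w, Odd (w.countP fun p => p.1.isP) ∨ Odd (w.countP fun p => p.1.isT) → L w = 0) := by
  have hex : ∀ w : List (Letter m × Bool), ∃ z : ℂ, (∀ n, 1 ≤ n → Integrable
      (fun ω => (starMonomial (fun i => modelMatrix n (a n) d i ω) w).trace) (μ n)) ∧
      Tendsto (fun n => matrixState (μ n) fun ω =>
        starMonomial (fun i => modelMatrix n (a n) d i ω) w) atTop (𝓝 z) := by
    intro w
    obtain ⟨G, -, -, hG⟩ := tendsto_filtered_word h hind hd w true
    have := hG (fun _ => true) rfl fun _ => rfl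
    simp only [List.filter_true] at this
    exact ⟨_, this⟩
  choose L hL using hex
  refine ⟨L, hL, fun w => ?_, fun w hw => ?_⟩
  · obtain ⟨G, -, hGP, hG⟩ := tendsto_filtered_word h hind hd w true
    obtain ⟨G', -, -, hG'⟩ := tendsto_filtered_word h hind hd w false
    have l₁ := hG (fun _ => true) rfl fun _ => rfl
    simp only [List.filter_true] at l₁
    have l₂ := hG' (fun x => !x.isT) rfl fun _ => rfl
    have l₃ := hG (fun x => !x.isD) rfl fun _ => rfl
    have l₄ := hG' (fun x => x.isP) rfl fun _ => rfl
    have hc : ∀ keep : Letter m → Bool, (∀ i, keep (.D i) = false) →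
        ∀ x, detSeq d keep x = Pi.single 0 1 := by
      rintro keep hk ⟨x, s, b⟩
      cases x <;> simp [detSeq, hk]
    have hc' : ∀ x, detSeq d (fun x => !x.isT) x = detSeq d (fun _ => true) x := by
      rintro ⟨x, s, b⟩
      cases x <;> simp [detSeq, Letter.isT]
    simp only [hc (fun x => !x.isD) fun _ => rfl, constantTerm_single, one_mul] at l₃
    simp only [hc (fun x => x.isP) fun _ => rfl, constantTerm_single, one_mul] at l₄
    simp only [hc'] at l₂
    rw [tendsto_nhds_unique (hL w).2 l₁.2, tendsto_nhds_unique (hL _).2 l₂.2,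
      tendsto_nhds_unique (hL _).2 l₃.2]
    by_cases hodd : Odd (w.countP fun p => p.1.isP)
    · rw [hGP hodd, mul_zero, mul_zero]
    -- `G'` is found by deleting the `D` letters too: an even power of `P` is the identity, whose
    -- state is `1` for `n ≥ 1`.
    · have hG1 : G' = 1 := by
        refine tendsto_nhds_unique l₄.2 (tendsto_const_nhds.congr' ?_)
        filter_upwards [eventually_ge_atTop 1] with n hn
        have hone : ∀ ω : Ω n, starMonomial (fun i => modelMatrix n (a n) d i ω)
            (w.filter fun p => p.1.isP) = 1 := by
          intro ω
          have := flipMatrix_mul_starMonomial n (a n) d (fun x => x.isP) rfl ω false w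
          have hseq : ∀ x, letterSeq n (a n) d (fun x => x.isP) ω x = Pi.single 0 1 := by
            rintro ⟨x, s, b⟩
            cases x <;> simp [letterSeq, Letter.isP]
          simp only [hseq, toeplitz_single_zero, List.map_const', List.prod_replicate, one_pow,
            finalFlip_eq, hodd, decide_false, Bool.xor_false, flipMatrix, Bool.false_eq_true,
            if_false, one_mul] at this
          exact this
        simp only [matrixState, hone, Matrix.trace_one, Fintype.card_fin, integral_const,
          probReal_univ, one_smul]
        rw [inv_mul_cancel₀]
        exact_mod_cast (by omega : n ≠ 0)
      rw [hG1, mul_one]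
  · obtain ⟨G, hGT, hGP, hG⟩ := tendsto_filtered_word h hind hd w true
    have l₁ := hG (fun _ => true) rfl fun _ => rfl
    simp only [List.filter_true] at l₁
    rw [tendsto_nhds_unique (hL w).2 l₁.2]
    rcases hw with hw | hw
    · rw [hGP hw, mul_zero]
    · rw [hGT rfl hw, mul_zero]

end Words

/-! ### The `*`-algebra of noncommutative `*`-polynomials -/

/-- The algebra of noncommutative polynomials in the variables `x i` and their adjoints. -/
def StarPolynomial (ι : Type*) := MonoidAlgebra ℂ (FreeMonoid (ι × Bool))

namespace StarPolynomial

variable {ι : Type*}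

noncomputable instance : Ring (StarPolynomial ι) :=
  inferInstanceAs (Ring (MonoidAlgebra ℂ (FreeMonoid (ι × Bool))))

noncomputable instance : Algebra ℂ (StarPolynomial ι) :=
  inferInstanceAs (Algebra ℂ (MonoidAlgebra ℂ (FreeMonoid (ι × Bool))))

/-- The monomial with the given letters; `true` stands for an adjoint. -/
noncomputable def monomial : FreeMonoid (ι × Bool) →* StarPolynomial ι :=
  MonoidAlgebra.of ℂ (FreeMonoid (ι × Bool))

theorem induction_on {motive : StarPolynomial ι → Prop} (x : StarPolynomial ι)
    (mono : ∀ w, motive (monomial w)) (add : ∀ x y, motive x → motive y → motive (x + y))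
    (smul : ∀ (r : ℂ) x, motive x → motive (r • x)) : motive x :=
  MonoidAlgebra.induction_on (R := ℂ) (M := FreeMonoid (ι × Bool)) x mono add smul

/-- The algebra homomorphism given by the images of the letters. -/
noncomputable def lift {A : Type*} [Ring A] [Algebra ℂ A] (f : ι × Bool → A) :
    StarPolynomial ι →ₐ[ℂ] A :=
  MonoidAlgebra.lift ℂ A (FreeMonoid (ι × Bool)) (FreeMonoid.lift f)

theorem lift_monomial {A : Type*} [Ring A] [Algebra ℂ A] (f : ι × Bool → A)
    (w : FreeMonoid (ι × Bool)) : lift f (monomial w) = FreeMonoid.lift f w :=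
  MonoidAlgebra.lift_of _ _

/-- Complex conjugation of the coefficients. -/
noncomputable def conjCoeff : StarPolynomial ι →+* StarPolynomial ι :=
  MonoidAlgebra.mapRingHom (FreeMonoid (ι × Bool)) (starRingEnd ℂ)

theorem conjCoeff_monomial (w : FreeMonoid (ι × Bool)) : conjCoeff (monomial w) = monomial w := by
  change MonoidAlgebra.mapRingHom _ (starRingEnd ℂ) (MonoidAlgebra.single w 1) =
    MonoidAlgebra.single w 1
  rw [MonoidAlgebra.mapRingHom_single, map_one]

theorem conjCoeff_smul (r : ℂ) (x : StarPolynomial ι) :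
    conjCoeff (r • x) = star r • conjCoeff x := by
  rw [Algebra.smul_def, map_mul, Algebra.smul_def]
  congr 1
  change MonoidAlgebra.mapRingHom _ (starRingEnd ℂ) (MonoidAlgebra.single 1 r) =
    MonoidAlgebra.single 1 (star r)
  rw [MonoidAlgebra.mapRingHom_single]
  rfl

/-- An algebra homomorphism into the opposite algebra reverses products. It is linear over `ℂ`, so
the coefficients are conjugated beforehand. -/
noncomputable instance : Star (StarPolynomial ι) where
  star x := (lift (fun p : ι × Bool => MulOpposite.op (monomial (FreeMonoid.of (p.1, !p.2))))
    (conjCoeff x)).unop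

theorem star_def (x : StarPolynomial ι) : star x =
    (lift (fun p : ι × Bool => MulOpposite.op (monomial (FreeMonoid.of (p.1, !p.2))))
      (conjCoeff x)).unop := rfl

theorem star_mul' (x y : StarPolynomial ι) : star (x * y) = star y * star x := by
  simp only [star_def, map_mul, MulOpposite.unop_mul]

theorem star_add' (x y : StarPolynomial ι) : star (x + y) = star x + star y := by
  simp only [star_def, map_add, MulOpposite.unop_add]

theorem star_smul' (r : ℂ) (x : StarPolynomial ι) : star (r • x) = star r • star x := by
  simp only [star_def, conjCoeff_smul, map_smul, MulOpposite.unop_smul]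

theorem star_monomial_of (p : ι × Bool) :
    star (monomial (FreeMonoid.of p)) = monomial (FreeMonoid.of (p.1, !p.2)) := by
  simp only [star_def, conjCoeff_monomial, lift_monomial, FreeMonoid.lift_eval_of,
    MulOpposite.unop_op]

theorem star_one' : star (1 : StarPolynomial ι) = 1 := by
  simp only [star_def, map_one, MulOpposite.unop_one]

noncomputable instance : StarRing (StarPolynomial ι) where
  star_involutive x := by
    induction x using induction_on with
    | mono w =>
      induction w using FreeMonoid.inductionOn' with
      | one => rw [map_one, star_one', star_one']
      | of_mul p w ih =>
        rw [map_mul, star_mul', star_mul', ih, star_monomial_of, star_monomial_of, Bool.not_not]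
    | add x y hx hy => rw [star_add', star_add', hx, hy]
    | smul r x hx => rw [star_smul', star_smul', hx, star_star]
  star_mul := star_mul'
  star_add := star_add'

instance : StarModule ℂ (StarPolynomial ι) where
  star_smul := star_smul'

/-- The variable `x i`. -/
noncomputable def X (i : ι) : StarPolynomial ι := monomial (FreeMonoid.of (i, false))

theorem starMonomial_X (w : List (ι × Bool)) :
    starMonomial (X : ι → StarPolynomial ι) w = monomial (FreeMonoid.ofList w) := by
  induction w with
  | nil => exact (map_one _).symm
  | cons p w ih =>
    have : starMonomial (X : ι → StarPolynomial ι) (p :: w) =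
        (if p.2 then star (X p.1) else X p.1) * starMonomial X w := by simp [starMonomial]
    rw [this, ih, FreeMonoid.ofList_cons, map_mul]
    congr 1
    obtain ⟨i, b⟩ := p
    cases b
    · rfl
    · exact star_monomial_of (i, false)

/-- Evaluation of a noncommutative `*`-polynomial. -/
noncomputable def eval {A : Type*} [Ring A] [Algebra ℂ A] [Star A] (x : ι → A) :
    StarPolynomial ι →ₐ[ℂ] A :=
  lift fun p => if p.2 then star (x p.1) else x p.1

theorem eval_monomial {A : Type*} [Ring A] [Algebra ℂ A] [Star A] (x : ι → A)
    (w : FreeMonoid (ι × Bool)) : eval x (monomial w) = starMonomial x w.toList := by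
  rw [eval, lift_monomial, FreeMonoid.lift_apply]
  rfl

theorem eval_star {A : Type*} [Ring A] [Algebra ℂ A] [StarRing A] [StarModule ℂ A] (x : ι → A)
    (f : StarPolynomial ι) : eval x (star f) = star (eval x f) := by
  induction f using induction_on with
  | mono w =>
    induction w using FreeMonoid.inductionOn' with
    | one => rw [map_one, star_one', map_one, star_one]
    | of_mul p w ih =>
      rw [map_mul, star_mul', map_mul, map_mul, star_mul, ih, star_monomial_of]
      simp only [eval, lift_monomial, FreeMonoid.lift_eval_of]
      cases p.2 <;> simp
  | add f g hf hg => rw [star_add', map_add, map_add, star_add, hf, hg]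
  | smul r f hf => rw [star_smul', map_smul, map_smul, star_smul, hf]

/-- The linear functional with given values on the monomials. -/
noncomputable def functional (L : List (ι × Bool) → ℂ) : StarPolynomial ι →ₗ[ℂ] ℂ where
  toFun f := Finsupp.linearCombination ℂ (fun w : FreeMonoid (ι × Bool) => L w.toList)
    (MonoidAlgebra.coeff f)
  map_add' f g := map_add (Finsupp.linearCombination ℂ _) (MonoidAlgebra.coeff f)
    (MonoidAlgebra.coeff g)
  map_smul' r f := map_smul (Finsupp.linearCombination ℂ _) r (MonoidAlgebra.coeff f)

theorem functional_monomial (L : List (ι × Bool) → ℂ) (w : FreeMonoid (ι × Bool)) :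
    functional L (monomial w) = L w.toList := by
  change Finsupp.linearCombination ℂ _ (MonoidAlgebra.coeff (MonoidAlgebra.single w 1)) = _
  simp

end StarPolynomial

/-! ### The limit state and its positivity -/

/-- Positivity concerns polynomials `f * star f`, so convergence must pass from monomials to linear
combinations; integrability is carried along to make the expectation additive. -/
theorem tendsto_matrixState_eval {ι : Type*} {Ω : ℕ → Type*} [∀ n, MeasurableSpace (Ω n)]
    {μ : ∀ n, Measure (Ω n)} {A : ∀ n, ι → Ω n → Matrix (Fin n) (Fin n) ℂ}
    {L : List (ι × Bool) → ℂ}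
    (hL : ∀ w, (∀ n, 1 ≤ n →
        Integrable (fun ω => (starMonomial (fun i => A n i ω) w).trace) (μ n)) ∧
      Tendsto (fun n => matrixState (μ n) fun ω => starMonomial (fun i => A n i ω) w) atTop
        (𝓝 (L w))) (f : StarPolynomial ι) :
    (∀ n, 1 ≤ n →
        Integrable (fun ω => (StarPolynomial.eval (fun i => A n i ω) f).trace) (μ n)) ∧
      Tendsto (fun n => matrixState (μ n) fun ω => StarPolynomial.eval (fun i => A n i ω) f) atTop
        (𝓝 (StarPolynomial.functional L f)) := by
  induction f using StarPolynomial.induction_on with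
  | mono w =>
    simp only [StarPolynomial.eval_monomial, StarPolynomial.functional_monomial]
    exact hL _
  | add f g hf hg =>
    simp only [map_add, Matrix.trace_add]
    refine ⟨fun n hn => (hf.1 n hn).add (hg.1 n hn), (hf.2.add hg.2).congr' ?_⟩
    filter_upwards [eventually_ge_atTop 1] with n hn
    simp only [matrixState, Matrix.trace_add]
    rw [integral_add (hf.1 n hn) (hg.1 n hn), mul_add]
  | smul r f hf =>
    simp only [map_smul, Matrix.trace_smul]
    refine ⟨fun n hn => (hf.1 n hn).smul r, (hf.2.const_smul r).congr fun n => ?_⟩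
    simp only [matrixState, Matrix.trace_smul]
    rw [integral_smul, smul_eq_mul, smul_eq_mul]
    ring

theorem matrixState_mul_star_nonneg {Ω : Type*} [MeasurableSpace Ω] (μ : Measure Ω) {n : ℕ}
    (B : Ω → Matrix (Fin n) (Fin n) ℂ) :
    0 ≤ (matrixState μ fun ω => B ω * star (B ω)).re ∧
      (matrixState μ fun ω => B ω * star (B ω)).im = 0 := by
  have htr : ∀ ω, (B ω * star (B ω)).trace = ((∑ i, ∑ j, ‖B ω i j‖ ^ 2 : ℝ) : ℂ) := by
    intro ω
    simp only [Matrix.trace, Matrix.diag_apply, Matrix.mul_apply, Matrix.star_apply,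
      Complex.ofReal_sum, Complex.ofReal_pow]
    exact Finset.sum_congr rfl fun i _ => Finset.sum_congr rfl fun j _ => Complex.mul_conj' _
  have : matrixState μ (fun ω => B ω * star (B ω)) =
      (((n : ℝ)⁻¹ * ∫ ω, ∑ i, ∑ j, ‖B ω i j‖ ^ 2 ∂μ : ℝ) : ℂ) := by
    simp only [matrixState, htr]
    rw [integral_complex_ofReal]
    push_cast
    rfl
  rw [this]
  refine ⟨?_, Complex.ofReal_im _⟩
  rw [Complex.ofReal_re]
  -- No integrability is needed: the integral of a nonnegative function is nonnegative, being `0` by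
  -- convention if it diverges.
  exact mul_nonneg (by positivity) (integral_nonneg fun ω => by positivity)

/-- Random matrices whose `*`-moments converge have a limit in `*`-distribution. -/
theorem exists_starProbabilitySpace {ι : Type} {Ω : ℕ → Type*} [∀ n, MeasurableSpace (Ω n)]
    {μ : ∀ n, Measure (Ω n)} [∀ n, IsProbabilityMeasure (μ n)]
    {A : ∀ n, ι → Ω n → Matrix (Fin n) (Fin n) ℂ} {L : List (ι × Bool) → ℂ}
    (hL : ∀ w, (∀ n, 1 ≤ n →
        Integrable (fun ω => (starMonomial (fun i => A n i ω) w).trace) (μ n)) ∧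
      Tendsto (fun n => matrixState (μ n) fun ω => starMonomial (fun i => A n i ω) w) atTop
        (𝓝 (L w))) :
    ∃ (S : StarProbabilitySpace) (x : ι → S.carrier), ∀ w, S.φ (starMonomial x w) = L w := by
  refine ⟨
    { carrier := StarPolynomial ι
      φ := StarPolynomial.functional L
      φ_one := ?_
      φ_nonneg := fun f => ?_ }, StarPolynomial.X, fun w => ?_⟩
  · rw [← map_one StarPolynomial.monomial, StarPolynomial.functional_monomial]
    refine tendsto_nhds_unique (hL _).2 (tendsto_const_nhds.congr' ?_)
    filter_upwards [eventually_ge_atTop 1] with n hn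
    simp only [matrixState, FreeMonoid.toList_one, starMonomial, List.map_nil, List.prod_nil,
      Matrix.trace_one, Fintype.card_fin, integral_const, probReal_univ, one_smul]
    rw [inv_mul_cancel₀]
    exact_mod_cast (by omega : n ≠ 0)
  · have h := (tendsto_matrixState_eval hL (f * star f)).2
    simp only [map_mul, StarPolynomial.eval_star] at h
    have hnn := fun n => matrixState_mul_star_nonneg (μ n)
      fun ω => StarPolynomial.eval (fun i => A n i ω) f
    refine ⟨ge_of_tendsto' ((Complex.continuous_re.tendsto _).comp h) fun n => (hnn n).1, ?_⟩
    exact tendsto_nhds_unique ((Complex.continuous_im.tendsto _).comp h)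
      (tendsto_const_nhds.congr fun n => (hnn n).2.symm)
  · change StarPolynomial.functional L (starMonomial StarPolynomial.X w) = L w
    rw [StarPolynomial.starMonomial_X, StarPolynomial.functional_monomial]
    rfl

/-! ### Joint convergence and factorization -/

theorem theorem2p1 {m : ℕ} {Ω₀ Ω : ℕ → Type*}
    [∀ n, MeasurableSpace (Ω₀ n)] [∀ n, MeasurableSpace (Ω n)]
    (μ₀ : ∀ n, Measure (Ω₀ n)) [∀ n, IsProbabilityMeasure (μ₀ n)]
    (μ : ∀ n, Measure (Ω n)) [∀ n, IsProbabilityMeasure (μ n)]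
    (σx σy ρ₁ ρ₂ ρ₃ ρ₄ ρ₅ ρ₆ : ℝ) (c : ℕ → ℝ)
    -- the input sequence of `T_n`
    (a₀ : ∀ n, ℤ → Ω₀ n → ℂ)
    (ha₀ : ∀ n, 1 ≤ n → PairCorrelated (μ₀ n) σx σy ρ₁ ρ₂ ρ₃ ρ₄ ρ₅ ρ₆ c (a₀ n))
    -- its `m` independent copies
    (a : ∀ n, Fin m → ℤ → Ω n → ℂ)
    (ha_meas : ∀ n, 1 ≤ n → ∀ i j, Measurable (a n i j))
    (ha_copy : ∀ n, 1 ≤ n → ∀ i,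
      IdentDistrib (fun ω j => a n i j ω) (fun ω j => a₀ n j ω) (μ n) (μ₀ n))
    (ha_indep : ∀ n, 1 ≤ n → iIndepFun (fun i ω j => a n i j ω) (μ n))
    -- the deterministic input sequences
    (d : Fin m → ℤ → ℂ) (hd : ∀ i, Summable fun k => ‖d i k‖) :
    ∃ (S : StarProbabilitySpace) (x : Letter m → S.carrier),
      ConvergesInStarDistribution μ (fun n => modelMatrix n (a n) d) S x ∧
      (∀ w : List (Letter m × Bool),
        S.φ (starMonomial x w) =
          S.φ (starMonomial x (w.filter fun p => !p.1.isT)) *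
          S.φ (starMonomial x (w.filter fun p => !p.1.isD))) ∧
      (∀ w : List (Letter m × Bool),
        Odd (w.countP fun p => p.1.isP) ∨ Odd (w.countP fun p => p.1.isT) →
          S.φ (starMonomial x w) = 0) := by
  have h : ∀ n, 1 ≤ n → ∀ i, PairCorrelated (μ n) σx σy ρ₁ ρ₂ ρ₃ ρ₄ ρ₅ ρ₆ c (a n i) :=
    fun n hn i => (ha₀ n hn).of_identDistrib (ha_meas n hn i) (ha_copy n hn i)
  obtain ⟨L, h₁, h₂, h₃⟩ := exists_momentLimit h ha_indep hd
  obtain ⟨S, x, hx⟩ := exists_starProbabilitySpace h₁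
  refine ⟨S, x, fun w => ?_, fun w => ?_, fun w hw => ?_⟩
  · rw [hx]
    exact h₁ w
  · rw [hx, hx, hx]
    exact h₂ w
  · rw [hx]
    exact h₃ w hw
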